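/- Let $N\ge 2$, $\mathfrak g=\mathfrak{sl}_N(\mathbb C)$ with Killing form $K$, and equip $\mathfrak g\oplus\mathfrak g$ with the form $Q((a,b),(c,d))=K(a,c)-K(b,d)$. Let $P_{N-1}\subset\mathfrak g$ be the maximal parabolic subalgebra consisting of the matrices $x$ with $x_{Nj}=0$ for $j<N$, and let $(P_{N-1},P_{N-1},\mathrm{id})$ be the set of pairs $(x,y)\in P_{N-1}\oplus P_{N-1}$ whose block diagonal (Levi) parts, with blocks of sizes $N-1$ and $1$, coincide. Let $\sigma_N$ be the permutation matrix with $\sigma_Ne_j=e_{j+1}$ for $j<N$ and $\sigma_Ne_N=e_1$, and let $W=\{(x,\sigma_Nx\sigma_N^{-1}) : x\in\mathfrak g\}$ be the subspace of $\mathfrak g\oplus\mathfrak g$ attached to the triple $(\mathfrak{sl}_N,\mathfrak{sl}_N,\mathrm{Ad}(\sigma_N))$. Then $W$ is a Lie subalgebra of $\mathfrak g\oplus\mathfrak g$, it is Lagrangian with respect to $Q$ (that is, $W^\perp=W$), and it is transversal to $(P_{N-1},P_{N-1},\mathrm{id})$, that is, $\mathfrak g\oplus\mathfrak g=W\oplus(P_{N-1},P_{N-1},\mathrm{id})$.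 Moreover $W$ defines a quasi-trigonometric $r$-matrix, in the following sense. Let $\Omega_+$ and $\Omega_-$ be the images in $\mathfrak g\otimes\mathfrak g$, under the projection $x\mapsto x-\tfrac1N\mathrm{tr}(x)1$ in both factors, of $\tfrac12\sum_i e_{ii}\otimes e_{ii}+\sum_{i<j}e_{ij}\otimes e_{ji}$ and of $\tfrac12\sum_i e_{ii}\otimes e_{ii}+\sum_{i<j}e_{ji}\otimes e_{ij}$. Let $D=\mathrm{diag}(1,\dots,1,u)$ and $$\widetilde W=\{(D^{-1}f(u)D,\,b)\;:\; f\in\mathfrak g[[u^{-1}]],\ (f(\infty),b)\in W\}\subset\mathfrak g((u^{-1}))\oplus\mathfrak g .$$ Then there is exactly one polynomial $p(u,v)$ with coefficients in $\mathfrak g\otimes\mathfrak g$ such that, for $$X(u,v)=\frac{u\,\Omega_++v\,\Omega_-}{u-v}+p(u,v),$$ and for all $k\ge 0$ and $\xi\in\mathfrak g^*$, the pair formed by the coefficients at $v^k$ of $(\mathrm{id}\otimes\xi)X(u,v)$, expanded at $u=\infty$, and of $(\mathrm{id}\otimes\xi)X(0,v)$ lies in $\widetilde W$. For this $p$ one has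 $p\neq 0$, the function $X$ satisfies the classical Yang–Baxter equation $$[X^{12}(u_1,u_2),X^{13}(u_1,u_3)]+[X^{12}(u_1,u_2),X^{23}(u_2,u_3)]+[X^{13}(u_1,u_3),X^{23}(u_2,u_3)]=0,$$ and $X^{12}(u,v)=-X^{21}(v,u)$. (This $X$ is the affine Cremmer–Gervais I $r$-matrix.) -/

import Mathlib

open scoped TensorProduct

namespace QuasiTrig

noncomputable section

attribute [local instance] LieRing.ofAssociativeRing LieAlgebra.ofAssociativeAlgebra

/-- The Lie algebra `𝔰𝔩_N` over `ℂ`. -/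
abbrev Sl (N : ℕ) : Type := LieAlgebra.SpecialLinear.sl (Fin N) ℂ

theorem mem_sl_iff {N : ℕ} (x : Matrix (Fin N) (Fin N) ℂ) :
    x ∈ LieAlgebra.SpecialLinear.sl (Fin N) ℂ ↔ x.trace = 0 :=
  Iff.rfl

/-! ### Lagrangian subalgebras of `𝔰𝔩_N ⊕ 𝔰𝔩_N` -/

/-- The form `Q((a,b),(c,d)) = K(a,c) - K(b,d)` on `𝔰𝔩_N ⊕ 𝔰𝔩_N`, with `K` the Killing form. -/
def formQ (N : ℕ) : LinearMap.BilinForm ℂ (Sl N × Sl N) :=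
  (killingForm ℂ (Sl N)).compl₁₂ (LinearMap.fst ℂ (Sl N) (Sl N)) (LinearMap.fst ℂ (Sl N) (Sl N)) -
  (killingForm ℂ (Sl N)).compl₁₂ (LinearMap.snd ℂ (Sl N) (Sl N)) (LinearMap.snd ℂ (Sl N) (Sl N))

/-- The subspace of `L ⊕ L` attached to a triple `(S₁, S₂, T)`. Here `S_k = R_k ⊕ n_k` with
reductive part `R_k` and nilradical `n_k`, and `T : R₁ → R₂` is an isomorphism. The subspace
consists of the pairs `(x, y) ∈ S₁ × S₂` such that `T` maps the reductive part of `x` to the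
reductive part of `y`. -/
def tripleSubspace {L : Type*} [LieRing L] [LieAlgebra ℂ L]
    (R₁ R₂ : LieSubalgebra ℂ L) (n₁ n₂ : Submodule ℂ L) (T : R₁ ≃ₗ⁅ℂ⁆ R₂) :
    Submodule ℂ (L × L) where
  carrier := {w | ∃ r : R₁, w.1 - (r : L) ∈ n₁ ∧ w.2 - (T r : L) ∈ n₂}
  zero_mem' := ⟨0, by simp, by simp⟩
  add_mem' := by
    rintro w w' ⟨r, h1, h2⟩ ⟨r', h1', h2'⟩
    refine ⟨r + r', ?_, ?_⟩
    · simpa [add_sub_add_comm] using n₁.add_mem h1 h1'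
    · simpa [add_sub_add_comm] using n₂.add_mem h2 h2'
  smul_mem' := by
    rintro c w ⟨r, h1, h2⟩
    refine ⟨c • r, ?_, ?_⟩
    · simpa [smul_sub] using n₁.smul_mem c h1
    · simpa [smul_sub] using n₂.smul_mem c h2

/-- The reductive (Levi) part of the maximal parabolic subalgebra `P_i`: block diagonal traceless
matrices with blocks of sizes `i` and `N - i`. (Rows and columns are numbered from `0`.) -/
def parabolicLevi (N i : ℕ) : LieSubalgebra ℂ (Sl N) where
  carrier := {x | ∀ a b : Fin N, ¬((a : ℕ) < i ↔ (b : ℕ) < i) → x.1 a b = 0}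
  zero_mem' := by intro a b _; rfl
  add_mem' := by
    intro x y hx hy a b h
    have h1 := hx a b h
    have h2 := hy a b h
    simp_all
  smul_mem' := by
    intro c x hx a b h
    have h1 := hx a b h
    simp_all
  lie_mem' := by
    intro x y hx hy a b h
    have key : ∀ z w : Sl N,
        (∀ a b : Fin N, ¬((a : ℕ) < i ↔ (b : ℕ) < i) → z.1 a b = 0) →
        (∀ a b : Fin N, ¬((a : ℕ) < i ↔ (b : ℕ) < i) → w.1 a b = 0) →
        (z.1 * w.1) a b = 0 := by
      intro z w hz hw
      rw [Matrix.mul_apply]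
      refine Finset.sum_eq_zero fun c _ => ?_
      by_cases hac : ((a : ℕ) < i ↔ (c : ℕ) < i)
      · rw [hw c b (by tauto), mul_zero]
      · rw [hz a c hac, zero_mul]
    rw [LieAlgebra.SpecialLinear.sl_bracket, Matrix.sub_apply, key x y hx hy, key y x hy hx,
      sub_zero]

/-- The nilradical of the maximal parabolic subalgebra `P_i`: the upper right block. -/
def parabolicNil (N i : ℕ) : Submodule ℂ (Sl N) where
  carrier := {x | ∀ a b : Fin N, ¬((a : ℕ) < i ∧ i ≤ (b : ℕ)) → x.1 a b = 0}
  zero_mem' := by intro a b _; rfl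
  add_mem' := by
    intro x y hx hy a b h
    have h1 := hx a b h
    have h2 := hy a b h
    simp_all
  smul_mem' := by
    intro c x hx a b h
    have h1 := hx a b h
    simp_all

/-- The Lagrangian subalgebra `(P_i, P_i, id)` of `𝔰𝔩_N ⊕ 𝔰𝔩_N`, where `P_i` is the maximal
parabolic subalgebra that contains all positive root vectors and omits the negative root vectors
whose root involves the simple root `α_i`. -/
def parabolicTriple (N i : ℕ) : Submodule ℂ (Sl N × Sl N) :=
  tripleSubspace (parabolicLevi N i) (parabolicLevi N i) (parabolicNil N i) (parabolicNil N i)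
    LieEquiv.refl

/-- `Ad(g) : x ↦ g x g⁻¹` as an automorphism of the Lie algebra `𝔰𝔩_N`. -/
def adSl {N : ℕ} (g : GL (Fin N) ℂ) : Sl N ≃ₗ⁅ℂ⁆ Sl N where
  toFun x := ⟨g.1 * x.1 * (g⁻¹).1, by
    have hx : Matrix.trace x.1 = 0 := x.2
    rw [mem_sl_iff, Matrix.trace_mul_comm, ← mul_assoc, Units.inv_mul, one_mul, hx]⟩
  map_add' x y := by ext1; simp [mul_add, add_mul]
  map_smul' c x := by ext1; simp
  map_lie' := by
    intro x y
    ext1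
    simp only [LieAlgebra.SpecialLinear.sl_bracket]
    simp only [mul_sub, sub_mul, mul_assoc, Units.inv_mul_cancel_left]
  invFun x := ⟨(g⁻¹).1 * x.1 * g.1, by
    have hx : Matrix.trace x.1 = 0 := x.2
    rw [mem_sl_iff, Matrix.trace_mul_comm, ← mul_assoc, Units.mul_inv, one_mul, hx]⟩
  left_inv x := by
    ext1; simp only [mul_assoc, Units.inv_mul, mul_one, Units.inv_mul_cancel_left]
  right_inv x := by
    ext1; simp only [mul_assoc, Units.mul_inv, mul_one, Units.mul_inv_cancel_left]

/-- The permutation matrix `σ_N` of the cycle `1 ↦ 2 ↦ ⋯ ↦ N ↦ 1`, that is, `σ_N e_j = e_{j+1}`.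
(Mathlib's `permMatrix π` has its ones at the places `(i, π i)`.) -/
def sigmaN (N : ℕ) : GL (Fin N) ℂ where
  val := Equiv.Perm.permMatrix ℂ (finRotate N)⁻¹
  inv := Equiv.Perm.permMatrix ℂ (finRotate N)
  val_inv := by rw [← Matrix.permMatrix_mul, mul_inv_cancel, Matrix.permMatrix_one]
  inv_val := by rw [← Matrix.permMatrix_mul, inv_mul_cancel, Matrix.permMatrix_one]

/-- The subspace of `𝔰𝔩_N ⊕ 𝔰𝔩_N` attached to the triple `(𝔰𝔩_N, 𝔰𝔩_N, Ad(σ_N))`; the reductive part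
of `𝔰𝔩_N` is `𝔰𝔩_N` itself and its nilradical is zero. -/
def cremmerGervaisI (N : ℕ) : Submodule ℂ (Sl N × Sl N) :=
  tripleSubspace ⊤ ⊤ ⊥ ⊥
    (LieSubalgebra.topEquiv.trans ((adSl (sigmaN N)).trans LieSubalgebra.topEquiv.symm))

/-! ### Quasi-trigonometric `r`-matrices -/

/-- The traceless part `x - (tr x / N) 1` of a matrix. -/
def toSl {N : ℕ} (x : Matrix (Fin N) (Fin N) ℂ) : Sl N :=
  ⟨x - (x.trace / N) • (1 : Matrix (Fin N) (Fin N) ℂ), by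
    rw [mem_sl_iff]
    rcases Nat.eq_zero_or_pos N with rfl | h
    · simp [Matrix.trace]
    · have : (N : ℂ) ≠ 0 := by exact_mod_cast h.ne'
      simp [Matrix.trace_sub, Matrix.trace_smul, this]⟩

/-- The traceless part of the matrix unit `e_{ij}` (it is `e_{ij}` itself if `i ≠ j`). -/
def unitSl {N : ℕ} (i j : Fin N) : Sl N := toSl (Matrix.single i j 1)

/-- `Ω₊ = ½ ∑ᵢ eᵢᵢ ⊗ eᵢᵢ + ∑_{i<j} e_{ij} ⊗ e_{ji}`, reduced to `𝔰𝔩_N`. -/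
def omegaPlus (N : ℕ) : Sl N ⊗[ℂ] Sl N :=
  (1 / 2 : ℂ) • ∑ i : Fin N, unitSl i i ⊗ₜ[ℂ] unitSl i i +
    ∑ i : Fin N, ∑ j : Fin N, if i < j then unitSl i j ⊗ₜ[ℂ] unitSl j i else 0

/-- `Ω₋ = ½ ∑ᵢ eᵢᵢ ⊗ eᵢᵢ + ∑_{i<j} e_{ji} ⊗ e_{ij}`, reduced to `𝔰𝔩_N`. -/
def omegaMinus (N : ℕ) : Sl N ⊗[ℂ] Sl N :=
  (1 / 2 : ℂ) • ∑ i : Fin N, unitSl i i ⊗ₜ[ℂ] unitSl i i +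
    ∑ i : Fin N, ∑ j : Fin N, if i < j then unitSl j i ⊗ₜ[ℂ] unitSl i j else 0

/-- Polynomials `p(u,v) = ∑ p_{kl} u^k v^l` with coefficients `p_{kl} ∈ 𝔰𝔩_N ⊗ 𝔰𝔩_N`. -/
abbrev TensorPoly (N : ℕ) : Type := (ℕ × ℕ) →₀ (Sl N ⊗[ℂ] Sl N)

/-- `X(u,v) = (u Ω₊ + v Ω₋) / (u - v) + p(u,v)`, used for `u ≠ v` only. -/
def rMat {N : ℕ} (p : TensorPoly N) (u v : ℂ) : Sl N ⊗[ℂ] Sl N :=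
  (u - v)⁻¹ • (u • omegaPlus N + v • omegaMinus N) +
    p.sum fun m c => (u ^ m.1 * v ^ m.2) • c

/-- `N × N` matrices, the associative algebra in whose tensor cube commutators are computed. -/
abbrev Mat (N : ℕ) : Type := Matrix (Fin N) (Fin N) ℂ

/-- The inclusion `𝔰𝔩_N ⊗ 𝔰𝔩_N → Mat_N ⊗ Mat_N`. -/
def slIncl (N : ℕ) : Sl N ⊗[ℂ] Sl N →ₗ[ℂ] Mat N ⊗[ℂ] Mat N :=
  TensorProduct.map (LieAlgebra.SpecialLinear.sl (Fin N) ℂ).toSubmodule.subtype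
    (LieAlgebra.SpecialLinear.sl (Fin N) ℂ).toSubmodule.subtype

/-- `a ⊗ b ↦ a ⊗ b ⊗ 1`. -/
def leg12 (N : ℕ) (t : Sl N ⊗[ℂ] Sl N) : Mat N ⊗[ℂ] (Mat N ⊗[ℂ] Mat N) :=
  Algebra.TensorProduct.map (AlgHom.id ℂ (Mat N)) Algebra.TensorProduct.includeLeft (slIncl N t)

/-- `a ⊗ b ↦ a ⊗ 1 ⊗ b`. -/
def leg13 (N : ℕ) (t : Sl N ⊗[ℂ] Sl N) : Mat N ⊗[ℂ] (Mat N ⊗[ℂ] Mat N) :=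
  Algebra.TensorProduct.map (AlgHom.id ℂ (Mat N)) Algebra.TensorProduct.includeRight (slIncl N t)

/-- `a ⊗ b ↦ 1 ⊗ a ⊗ b`. -/
def leg23 (N : ℕ) (t : Sl N ⊗[ℂ] Sl N) : Mat N ⊗[ℂ] (Mat N ⊗[ℂ] Mat N) :=
  Algebra.TensorProduct.includeRight (slIncl N t)

/-- The commutator of two elements of an associative ring. -/
def comm {A : Type*} [Ring A] (a b : A) : A := a * b - b * a

/-- The classical Yang-Baxter equation
`[X¹²(u₁,u₂), X¹³(u₁,u₃)] + [X¹²(u₁,u₂), X²³(u₂,u₃)] + [X¹³(u₁,u₃), X²³(u₂,u₃)] = 0`. -/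
def IsCYBESolution {N : ℕ} (X : ℂ → ℂ → Sl N ⊗[ℂ] Sl N) : Prop :=
  ∀ u₁ u₂ u₃ : ℂ, u₁ ≠ u₂ → u₁ ≠ u₃ → u₂ ≠ u₃ →
    comm (leg12 N (X u₁ u₂)) (leg13 N (X u₁ u₃)) +
      comm (leg12 N (X u₁ u₂)) (leg23 N (X u₂ u₃)) +
      comm (leg13 N (X u₁ u₃)) (leg23 N (X u₂ u₃)) = 0

/-- Unitarity: `X¹²(u,v) = - X²¹(v,u)`. -/
def IsUnitary {N : ℕ} (X : ℂ → ℂ → Sl N ⊗[ℂ] Sl N) : Prop :=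
  ∀ u v : ℂ, u ≠ v → X u v = -TensorProduct.comm ℂ (Sl N) (Sl N) (X v u)

/-- `X(u,v) = (u Ω₊ + v Ω₋) / (u - v) + p(u,v)` is a quasi-trigonometric `r`-matrix. -/
def IsQuasiTrigonometric {N : ℕ} (p : TensorPoly N) : Prop :=
  p ≠ 0 ∧ IsCYBESolution (rMat p)

/-! ### The correspondence between Lagrangian subalgebras and `r`-matrices

`𝔤((u⁻¹))` is realized by matrices over the field of formal Laurent series in the variable `u⁻¹`,
and `𝔤[u]` sits in `𝔤((u⁻¹)) ⊕ 𝔤` through `a(u) ↦ (a(u), a(0))`. -/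

/-- `u ^ k` in the field `ℂ((u⁻¹))`, whose uniformizer is `u⁻¹`. -/
def uPow (k : ℤ) : LaurentSeries ℂ := HahnSeries.single (-k) 1

/-- Matrices over `ℂ((u⁻¹))`. -/
abbrev LoopMat (N : ℕ) : Type := Matrix (Fin N) (Fin N) (LaurentSeries ℂ)

/-- A constant matrix as a matrix over `ℂ((u⁻¹))`. -/
def constLoop {N : ℕ} (x : Sl N) : LoopMat N := x.1.map HahnSeries.C

/-- `D = diag(1, …, 1, u, …, u)` with `i` ones. -/
def gaugeD (N i : ℕ) : LoopMat N :=
  Matrix.diagonal fun a : Fin N => if (a : ℕ) < i then 1 else uPow 1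

/-- The subalgebra of `𝔤((u⁻¹)) ⊕ 𝔤`, `𝔤 = 𝔰𝔩_N`, attached to a subalgebra `W` of `𝔤 ⊕ 𝔤`: all pairs
`(D⁻¹ f(u) D, b)` with `f ∈ 𝔤[[u⁻¹]]` and `(f(∞), b) ∈ W`. In this way `𝔤 ⊕ 𝔤` is the subquotient
`(D⁻¹ 𝔤[[u⁻¹]] D ⊕ 𝔤) / (D⁻¹ u⁻¹𝔤[[u⁻¹]] D ⊕ 0)` of `𝔤((u⁻¹)) ⊕ 𝔤`, in which the image of `𝔤[u]` is
`(P_i, P_i, id)`. -/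
def loopLift {N : ℕ} (i : ℕ) (W : Submodule ℂ (Sl N × Sl N)) : Set (LoopMat N × Sl N) :=
  {w | ∃ f : LieAlgebra.SpecialLinear.sl (Fin N) (PowerSeries ℂ), ∃ a : Sl N,
      a.1 = f.1.map PowerSeries.constantCoeff ∧ (a, w.2) ∈ W ∧
      gaugeD N i * w.1 = f.1.map (HahnSeries.ofPowerSeries ℤ ℂ) * gaugeD N i}

/-- The contraction `(id ⊗ ξ) : 𝔤 ⊗ 𝔤 → 𝔤`. -/
def contract {N : ℕ} (ξ : Module.Dual ℂ (Sl N)) (t : Sl N ⊗[ℂ] Sl N) : Sl N :=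
  TensorProduct.rid ℂ (Sl N) (LinearMap.lTensor (Sl N) ξ t)

/-- The coefficient at `v^k` of `(id ⊗ ξ) X(u,v)`, where `X(u,v) = (u Ω₊ + v Ω₋)/(u - v) + p(u,v)`
is expanded at `u = ∞`, that is, as `Ω₊ + ∑_{k ≥ 1} (Ω₊ + Ω₋) v^k u^{-k} + p(u,v)`. -/
def coeffAtInfty {N : ℕ} (p : TensorPoly N) (k : ℕ) (ξ : Module.Dual ℂ (Sl N)) : LoopMat N :=
  (if k = 0 then constLoop (contract ξ (omegaPlus N))
    else uPow (-(k : ℤ)) • constLoop (contract ξ (omegaPlus N + omegaMinus N))) +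
  p.sum fun m c => if m.2 = k then uPow (m.1 : ℤ) • constLoop (contract ξ c) else 0

/-- The coefficient at `v^k` of `(id ⊗ ξ) X(0,v)`, where
`X(0,v) = (v Ω₋)/(0 - v) + p(0,v) = -Ω₋ + p(0,v)`. -/
def coeffAtZero {N : ℕ} (p : TensorPoly N) (k : ℕ) (ξ : Module.Dual ℂ (Sl N)) : Sl N :=
  (if k = 0 then -contract ξ (omegaMinus N) else 0) + contract ξ (p (0, k))

/-- `X(u,v) = (u Ω₊ + v Ω₋)/(u - v) + p(u,v)` is the `r`-matrix defined by `W`: it is the canonical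
element of the decomposition of `𝔤((u⁻¹)) ⊕ 𝔤` into the subalgebra attached to `W` and `𝔤[u]`. That
is, the coefficients of `X` in the second variable `v`, the first variable being expanded both
at `u = ∞` and at `u = 0`, lie in the subalgebra attached to `W`. (Whatever `p` is, the pairing of the `(k, ξ)`-coefficient
with `x u^m ∈ 𝔤[u]` under `Res u⁻¹ tr(f g) - tr(a b)` is `ξ(x)` if `k = m` and `0` otherwise.) -/
def IsDefinedBy {N : ℕ} (i : ℕ) (p : TensorPoly N) (W : Submodule ℂ (Sl N × Sl N)) : Prop :=
  ∀ (k : ℕ) (ξ : Module.Dual ℂ (Sl N)), (coeffAtInfty p k ξ, coeffAtZero p k ξ) ∈ loopLift i W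

end

end QuasiTrig

/-!
Everything except transversality holds for the graph `W` of any `Ad(g)` that is transversal to
`(P_i, P_i, id)`. The subspace `W` of the theorem is the graph of `Ad(σ_N)`. A pair `(x, σ x σ⁻¹)` in
`(P_{N-1}, P_{N-1}, id)` has entries constant along the diagonals of the large block; each diagonal
but the main one starts or ends at an entry that is known to vanish, and `tr x = 0`, so `x = 0`
(`eq_zero_of_cyclicShift`). A dimension count does the rest. `W` is Lagrangian because `Ad(g)` is
an isometry of the Killing form, which is `2N` times the trace form.

**Existence and uniqueness.** Write `X = v Ω / (u - v) + Ω₊ + p` with the Casimir tensor `Ω`, and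
compare Laurent coefficients. Then `X` is defined by `W` if and only if `p` has degree at most one in
`u` and certain pairs, which lie in `(P_i, P_i, id)` up to explicit terms coming from `Ω`, lie in `W`
(`isDefinedBy_iff`). Since `W` is transversal to `(P_i, P_i, id)`, there is exactly one solution; it
is obtained by applying the projection onto `(P_i, P_i, id)` along `W` (`constTerm`, `linTerm`) to
the explicit terms (`isDefinedBy_rPoly`, `isDefinedBy_unique`). One of these terms is not in `W`,
which forces `p ≠ 0`. The result has the form `X = v Ω / (u - v) + (T ⊗ 1) Ω` with an operator
`T = regOp h u v` of degree one in `u` and in `v` (`rMat_rPoly`).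

**Unitarity.** `X¹²(u,v) = -X²¹(v,u)` is an identity between `T` and its adjoint for the trace form,
and this identity says that `W` is isotropic (`trForm_constTerm_add_linTerm`).

**The Yang-Baxter equation.** As a function of its first variable `u`, the left hand side `E` has at
most simple poles at `u = v` and `u = w`. Their residues vanish because `Ω` is invariant, for the
second pole after an application of unitarity (`comm_leg12_omega`, `comm_leg13_omega`). So `E` is a
polynomial in `u` (`yangBaxter_eq_polynomial`). Its first leg lies in the subalgebra attached to `W`,
so after conjugation by `D` it has a limit `L` at `u = ∞`, and the value `C` at `u = 0` is the image
of `L` under `Ad(g)` in the first leg (`legMap_sub_eq_peirce`). But for a polynomial the pair `(L, C)`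
lies in `(P_i, P_i, id)` (`peirce_yangBaxter`), hence vanishes (`eq_zero_of_peirce`), and then all
coefficients of `E` vanish.
-/

open scoped TensorProduct

namespace QuasiTrig

noncomputable section

attribute [local instance] LieRing.ofAssociativeRing LieAlgebra.ofAssociativeAlgebra

/-! ### Block decomposition of matrices -/

/-- The diagonal idempotent projecting onto the first `i` coordinates. -/
def projFst (N i : ℕ) : Mat N := Matrix.diagonal fun a : Fin N => if (a : ℕ) < i then 1 else 0

/-- The diagonal idempotent projecting onto the last `N - i` coordinates. -/
def projSnd (N i : ℕ) : Mat N := Matrix.diagonal fun a : Fin N => if (a : ℕ) < i then 0 else 1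

theorem projFst_add_projSnd (N i : ℕ) : projFst N i + projSnd N i = 1 := by
  rw [projFst, projSnd, Matrix.diagonal_add, ← Matrix.diagonal_one]
  congr 1; funext a; split_ifs <;> simp

theorem projFst_mul_self (N i : ℕ) : projFst N i * projFst N i = projFst N i := by
  simp [projFst, Matrix.diagonal_mul_diagonal]

theorem projSnd_mul_self (N i : ℕ) : projSnd N i * projSnd N i = projSnd N i := by
  simp [projSnd, Matrix.diagonal_mul_diagonal]

theorem projFst_mul_projSnd (N i : ℕ) : projFst N i * projSnd N i = 0 := by
  rw [projFst, projSnd, Matrix.diagonal_mul_diagonal, Matrix.diagonal_eq_zero]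
  funext a; split_ifs <;> simp_all

theorem projSnd_mul_projFst (N i : ℕ) : projSnd N i * projFst N i = 0 := by
  rw [projFst, projSnd, Matrix.diagonal_mul_diagonal, Matrix.diagonal_eq_zero]
  funext a; split_ifs <;> simp_all

/-- The upper right block of a traceless matrix, for blocks of sizes `i` and `N - i`. -/
def upperPart (N i : ℕ) : Sl N →ₗ[ℂ] Sl N where
  toFun x := ⟨projFst N i * x.1 * projSnd N i, by
    rw [mem_sl_iff, Matrix.trace_mul_comm, ← mul_assoc, projSnd_mul_projFst, zero_mul,
      Matrix.trace_zero]⟩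
  map_add' x y := by ext1; simp [mul_add, add_mul]
  map_smul' c x := by ext1; simp

/-- The lower left block of a traceless matrix, for blocks of sizes `i` and `N - i`. -/
def lowerPart (N i : ℕ) : Sl N →ₗ[ℂ] Sl N where
  toFun x := ⟨projSnd N i * x.1 * projFst N i, by
    rw [mem_sl_iff, Matrix.trace_mul_comm, ← mul_assoc, projFst_mul_projSnd, zero_mul,
      Matrix.trace_zero]⟩
  map_add' x y := by ext1; simp [mul_add, add_mul]
  map_smul' c x := by ext1; simp

/-- The block diagonal part of a traceless matrix, for blocks of sizes `i` and `N - i`. -/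
def leviPart (N i : ℕ) : Sl N →ₗ[ℂ] Sl N := LinearMap.id - upperPart N i - lowerPart N i

variable {N i : ℕ}

theorem upperPart_apply (x : Sl N) (a b : Fin N) :
    (upperPart N i x).1 a b = if (a : ℕ) < i ∧ i ≤ (b : ℕ) then x.1 a b else 0 := by
  simp only [upperPart, LinearMap.coe_mk, AddHom.coe_mk, projFst, projSnd, Matrix.mul_diagonal,
    Matrix.diagonal_mul]
  split_ifs <;> first | omega | simp

theorem lowerPart_apply (x : Sl N) (a b : Fin N) :
    (lowerPart N i x).1 a b = if i ≤ (a : ℕ) ∧ (b : ℕ) < i then x.1 a b else 0 := by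
  simp only [lowerPart, LinearMap.coe_mk, AddHom.coe_mk, projFst, projSnd, Matrix.mul_diagonal,
    Matrix.diagonal_mul]
  split_ifs <;> first | omega | simp

theorem leviPart_apply (x : Sl N) (a b : Fin N) :
    (leviPart N i x).1 a b = if ((a : ℕ) < i ↔ (b : ℕ) < i) then x.1 a b else 0 := by
  have : (leviPart N i x).1 a b
      = x.1 a b - (upperPart N i x).1 a b - (lowerPart N i x).1 a b := rfl
  rw [this, upperPart_apply, lowerPart_apply]
  split_ifs <;> first | omega | simp

theorem leviPart_coe (x : Sl N) : (leviPart N i x).1 =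
    projFst N i * x.1 * projFst N i + projSnd N i * x.1 * projSnd N i := by
  ext a b
  simp only [leviPart_apply, projFst, projSnd, Matrix.add_apply, Matrix.mul_diagonal,
    Matrix.diagonal_mul]
  split_ifs <;> first | omega | simp

theorem sl_ext {x y : Sl N} (h : ∀ a b, x.1 a b = y.1 a b) : x = y :=
  Subtype.ext (Matrix.ext h)

theorem mem_parabolicTriple_iff (w : Sl N × Sl N) :
    w ∈ parabolicTriple N i ↔
      lowerPart N i w.1 = 0 ∧ lowerPart N i w.2 = 0 ∧ leviPart N i w.1 = leviPart N i w.2 := by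
  constructor
  · rintro ⟨⟨r, hr⟩, h1, h2⟩
    have h1' : ∀ a b : Fin N, ¬((a : ℕ) < i ∧ i ≤ (b : ℕ)) → w.1.1 a b = r.1 a b :=
      fun a b h => sub_eq_zero.1 (h1 a b h)
    have h2' : ∀ a b : Fin N, ¬((a : ℕ) < i ∧ i ≤ (b : ℕ)) → w.2.1 a b = r.1 a b :=
      fun a b h => sub_eq_zero.1 (h2 a b h)
    refine ⟨sl_ext fun a b => ?_, sl_ext fun a b => ?_, sl_ext fun a b => ?_⟩
    · rw [lowerPart_apply]
      split_ifs with h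
      · rw [h1' a b (by omega)]; exact hr a b (by omega)
      · rfl
    · rw [lowerPart_apply]
      split_ifs with h
      · rw [h2' a b (by omega)]; exact hr a b (by omega)
      · rfl
    · rw [leviPart_apply, leviPart_apply]
      split_ifs with h
      · rw [h1' a b (by omega), h2' a b (by omega)]
      · rfl
  · rintro ⟨h1, h2, h3⟩
    have key : ∀ x : Sl N, lowerPart N i x = 0 → x - leviPart N i x ∈ parabolicNil N i := by
      intro x hx a b h
      have h0 : (lowerPart N i x).1 a b = 0 := by rw [hx]; rfl
      change x.1 a b - (leviPart N i x).1 a b = 0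
      rw [leviPart_apply]
      rw [lowerPart_apply] at h0
      split_ifs at h0 ⊢ with h4 h5 h5
      · omega
      · simp
      · simpa using h0
      · omega
    refine ⟨⟨leviPart N i w.1, fun a b h => ?_⟩, key _ h1, ?_⟩
    · rw [leviPart_apply, if_neg h]
    · have := key _ h2
      rw [← h3] at this
      exact this

/-! ### The graph of a conjugation -/

theorem adSl_coe (g : GL (Fin N) ℂ) (x : Sl N) : (adSl g x).1 = g.1 * x.1 * (g⁻¹).1 := rfl

/-- The graph of `Ad(g)`, a subspace of `𝔰𝔩_N ⊕ 𝔰𝔩_N`. -/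
def adGraph (g : GL (Fin N) ℂ) : Submodule ℂ (Sl N × Sl N) :=
  LinearMap.graph ((adSl g : Sl N ≃ₗ⁅ℂ⁆ Sl N) : Sl N →ₗ[ℂ] Sl N)

theorem mem_adGraph_iff {g : GL (Fin N) ℂ} {w : Sl N × Sl N} :
    w ∈ adGraph g ↔ w.2 = adSl g w.1 := by
  rw [adGraph, LinearMap.mem_graph_iff]; rfl

theorem cremmerGervaisI_eq_adGraph (N : ℕ) : cremmerGervaisI N = adGraph (sigmaN N) := by
  ext w
  rw [mem_adGraph_iff]
  constructor
  · rintro ⟨r, h1, h2⟩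
    rw [Submodule.mem_bot, sub_eq_zero] at h1 h2
    rw [h1, h2]; rfl
  · intro h
    refine ⟨⟨w.1, trivial⟩, ?_, ?_⟩
    · simp
    · rw [h, Submodule.mem_bot, sub_eq_zero]; rfl

theorem lie_mem_adGraph {g : GL (Fin N) ℂ} {x y : Sl N × Sl N} (hx : x ∈ adGraph g)
    (hy : y ∈ adGraph g) : ⁅x, y⁆ ∈ adGraph g := by
  rw [mem_adGraph_iff] at *
  change ⁅x.2, y.2⁆ = adSl g ⁅x.1, y.1⁆
  rw [LieEquiv.map_lie, hx, hy]

/-! ### Transversality -/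

theorem adSl_sigmaN_apply (x : Sl N) (a b : Fin N) :
    (adSl (sigmaN N) x).1 (finRotate N a) (finRotate N b) = x.1 a b := by
  rw [adSl_coe]
  change (Equiv.Perm.permMatrix ℂ (finRotate N)⁻¹ * x.1 *
    Equiv.Perm.permMatrix ℂ (finRotate N)) _ _ = _
  rw [Equiv.Perm.permMatrix, Equiv.Perm.permMatrix, PEquiv.toMatrix_toPEquiv_mul,
    PEquiv.mul_toMatrix_toPEquiv]
  change x.1 ((finRotate N)⁻¹ (finRotate N a)) ((finRotate N)⁻¹ (finRotate N b)) = _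
  rw [Equiv.Perm.inv_def, Equiv.symm_apply_apply, Equiv.symm_apply_apply]

/-- A traceless matrix in the parabolic subalgebra with blocks of sizes `M` and `1` whose cyclic
shift lies there too and has the same block diagonal part is zero: its entries are constant along
the diagonals of the large block, each diagonal but the main one starts or ends at an entry known to
vanish, and the trace is zero. -/
theorem eq_zero_of_cyclicShift {M : ℕ} (hM : 1 ≤ M) (x y : Sl (M + 1))
    (hxy : ∀ a b, y.1 (finRotate _ a) (finRotate _ b) = x.1 a b)
    (hx : lowerPart (M + 1) M x = 0) (hy : lowerPart (M + 1) M y = 0)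
    (h : leviPart (M + 1) M x = leviPart (M + 1) M y) : x = 0 := by
  have low : ∀ z : Sl (M + 1), lowerPart (M + 1) M z = 0 →
      ∀ b (hb : b < M), z.1 ⟨M, by omega⟩ ⟨b, by omega⟩ = 0 := by
    intro z hz b hb
    have : (lowerPart (M + 1) M z).1 ⟨M, by omega⟩ ⟨b, by omega⟩ = 0 := by rw [hz]; rfl
    rwa [lowerPart_apply, if_pos ⟨le_rfl, hb⟩] at this
  have lev : ∀ a b : Fin (M + 1), ((a : ℕ) < M ↔ (b : ℕ) < M) → x.1 a b = y.1 a b := by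
    intro a b hab
    have : (leviPart (M + 1) M x).1 a b = (leviPart (M + 1) M y).1 a b := by rw [h]
    rwa [leviPart_apply, leviPart_apply, if_pos hab, if_pos hab] at this
  have rot : ∀ a (ha : a < M), finRotate (M + 1) ⟨a, by omega⟩ = ⟨a + 1, by omega⟩ :=
    fun a ha => finRotate_of_lt ha
  have rotLast : finRotate (M + 1) ⟨M, by omega⟩ = ⟨0, by omega⟩ := finRotate_last'
  have shift : ∀ a b (ha : a < M) (hb : b < M),
      y.1 ⟨a + 1, by omega⟩ ⟨b + 1, by omega⟩ = x.1 ⟨a, by omega⟩ ⟨b, by omega⟩ := by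
    intro a b ha hb
    rw [← rot a ha, ← rot b hb, hxy]
  have diag : ∀ k a b (ha : a + k < M) (hb : b + k < M),
      x.1 ⟨a + k, by omega⟩ ⟨b + k, by omega⟩ = x.1 ⟨a, by omega⟩ ⟨b, by omega⟩ := by
    intro k
    induction k with
    | zero => intros; rfl
    | succ k ih =>
      intro a b ha hb
      rw [← ih a b (by omega) (by omega), ← shift (a + k) (b + k) (by omega) (by omega)]
      exact lev _ _ (by simp only []; omega)
  have upper : ∀ a b (hab : a < b) (hb : b < M), x.1 ⟨a, by omega⟩ ⟨b, by omega⟩ = 0 := by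
    intro a b hab hb
    obtain ⟨d, rfl⟩ : ∃ d, b = d + 1 + a := ⟨b - a - 1, by omega⟩
    have h1 := diag a 0 (d + 1) (by omega) hb
    simp only [zero_add] at h1
    rw [h1, lev _ _ (by simp only []; omega), ← rotLast, ← rot d (by omega), hxy]
    exact low x hx d (by omega)
  have lower : ∀ a b (hab : b < a) (ha : a < M), x.1 ⟨a, by omega⟩ ⟨b, by omega⟩ = 0 := by
    intro a b hab ha
    obtain ⟨k, hk⟩ : ∃ k, M = a + k + 1 := ⟨M - 1 - a, by omega⟩
    rw [← diag k a b (by omega) (by omega), ← shift (a + k) (b + k) (by omega) (by omega)]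
    have := low y hy (b + k + 1) (by omega)
    simp only [hk] at this ⊢
    exact this
  have last : ∀ a (ha : a < M), x.1 ⟨a, by omega⟩ ⟨M, by omega⟩ = 0 := by
    intro a ha
    rw [← hxy, rot a ha, rotLast]
    rcases Nat.lt_or_ge (a + 1) M with h1 | h1
    · rw [← lev _ _ (by simp only []; omega)]
      exact lower (a + 1) 0 (by omega) h1
    · obtain rfl : M = a + 1 := by omega
      exact low y hy 0 (by omega)
  have diagonal : ∀ a : Fin (M + 1), x.1 a a = x.1 ⟨0, by omega⟩ ⟨0, by omega⟩ := by
    rintro ⟨a, ha⟩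
    rcases Nat.lt_or_ge a M with h1 | h1
    · have := diag a 0 0 (by omega) (by omega)
      simpa only [zero_add] using this
    · obtain rfl : a = M := by omega
      rw [← hxy, rotLast]
      exact (lev _ _ Iff.rfl).symm
  have zero : x.1 ⟨0, by omega⟩ ⟨0, by omega⟩ = 0 := by
    have htr : Matrix.trace x.1 = 0 := x.2
    rw [Matrix.trace, Finset.sum_congr rfl fun a _ =>
      (Matrix.diag_apply x.1 a).trans (diagonal a)] at htr
    simp only [Finset.sum_const, Finset.card_univ, Fintype.card_fin, smul_eq_zero] at htr
    exact htr.resolve_left (by omega)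
  refine sl_ext fun a b => ?_
  change x.1 a b = 0
  obtain ⟨a, ha⟩ := a
  obtain ⟨b, hb⟩ := b
  rcases Nat.lt_trichotomy a b with hab | rfl | hab
  · rcases Nat.lt_or_ge b M with h1 | h1
    · exact upper a b hab h1
    · obtain rfl : b = M := by omega
      exact last a hab
  · rw [diagonal, zero]
  · rcases Nat.lt_or_ge a M with h1 | h1
    · exact lower a b hab h1
    · have ha' : (⟨a, ha⟩ : Fin (M + 1)) = ⟨M, by omega⟩ := Fin.ext (by simp only []; omega)
      rw [ha']
      exact low x hx b (by omega)

theorem finrank_adGraph (g : GL (Fin N) ℂ) :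
    Module.finrank ℂ (adGraph g) = Module.finrank ℂ (Sl N) := by
  rw [adGraph, LinearMap.graph_eq_range_prod]
  exact LinearMap.finrank_range_of_inj fun x y h => congrArg Prod.fst h

/-- The transpose of a traceless matrix. -/
def transposeSl (N : ℕ) : Sl N →ₗ[ℂ] Sl N where
  toFun x := ⟨x.1.transpose, by rw [mem_sl_iff, Matrix.trace_transpose]; exact x.2⟩
  map_add' x y := by ext1; simp
  map_smul' c x := by ext1; simp

/-- `(P_i, P_i, id)` has at least half the dimension of `𝔰𝔩_N ⊕ 𝔰𝔩_N`: two upper blocks and one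
block diagonal part are the data of one traceless matrix. -/
theorem finrank_le_finrank_parabolicTriple (N i : ℕ) :
    Module.finrank ℂ (Sl N) ≤ Module.finrank ℂ (parabolicTriple N i) := by
  let φ : Sl N →ₗ[ℂ] Sl N × Sl N :=
    (leviPart N i + upperPart N i).prod
      (leviPart N i + upperPart N i ∘ₗ transposeSl N)
  have h1 : ∀ x a b, (φ x).1.1 a b = (leviPart N i x).1 a b + (upperPart N i x).1 a b :=
    fun _ _ _ => rfl
  have h2 : ∀ x a b, (φ x).2.1 a b =
      (leviPart N i x).1 a b + (upperPart N i (transposeSl N x)).1 a b := fun _ _ _ => rfl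
  have ht : ∀ (x : Sl N) a b, (transposeSl N x).1 a b = x.1 b a := fun _ _ _ => rfl
  have hφ : ∀ x, φ x ∈ parabolicTriple N i := by
    intro x
    rw [mem_parabolicTriple_iff]
    refine ⟨sl_ext fun a b => ?_, sl_ext fun a b => ?_, sl_ext fun a b => ?_⟩
    · change _ = (0 : ℂ)
      rw [lowerPart_apply, h1, leviPart_apply, upperPart_apply]
      split_ifs <;> first | omega | simp
    · change _ = (0 : ℂ)
      rw [lowerPart_apply, h2, leviPart_apply, upperPart_apply]
      split_ifs <;> first | omega | simp
    · rw [leviPart_apply, leviPart_apply, h1, h2, leviPart_apply, upperPart_apply, upperPart_apply]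
      split_ifs <;> first | omega | simp
  have hinj : Function.Injective (φ.codRestrict (parabolicTriple N i) hφ) := by
    rw [LinearMap.injective_codRestrict_iff, injective_iff_map_eq_zero]
    intro x hx
    refine sl_ext fun a b => ?_
    change x.1 a b = 0
    have e1 : (φ x).1.1 a b = 0 := by rw [hx]; rfl
    have e2 : (φ x).2.1 b a = 0 := by rw [hx]; rfl
    rw [h1, leviPart_apply, upperPart_apply] at e1
    rw [h2, leviPart_apply, upperPart_apply, ht] at e2
    split_ifs at e1 e2 <;> first | omega | simp_all
  exact LinearMap.finrank_le_finrank_of_injective hinj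

theorem isCompl_adGraph_parabolicTriple {N : ℕ} (hN : 2 ≤ N) :
    IsCompl (adGraph (sigmaN N)) (parabolicTriple N (N - 1)) := by
  obtain ⟨M, rfl⟩ : ∃ M, N = M + 1 := ⟨N - 1, by omega⟩
  rw [Nat.add_sub_cancel]
  refine (Submodule.isCompl_iff_disjoint _ _ ?_).2 ?_
  · rw [Module.finrank_prod, finrank_adGraph]
    have := finrank_le_finrank_parabolicTriple (M + 1) M
    omega
  · rw [Submodule.disjoint_def]
    rintro ⟨x, y⟩ hW hP
    rw [mem_adGraph_iff] at hW
    rw [mem_parabolicTriple_iff] at hP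
    dsimp only at hW hP
    have hx : x = 0 := eq_zero_of_cyclicShift (by omega) x y
      (fun a b => by rw [hW]; exact adSl_sigmaN_apply x a b) hP.1 hP.2.1 hP.2.2
    rw [hW, hx, map_zero]; rfl

/-! ### The trace form and the Killing form -/

/-- The trace form `(x, y) ↦ tr(xy)` on `𝔰𝔩_N`. -/
def trForm (N : ℕ) : Sl N →ₗ[ℂ] Sl N →ₗ[ℂ] ℂ :=
  LinearMap.mk₂ ℂ (fun x y => Matrix.trace (x.1 * y.1))
    (fun x y z => by simp [add_mul]) (fun c x y => by simp)
    (fun x y z => by simp [mul_add]) (fun c x y => by simp)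

theorem trForm_apply (x y : Sl N) : trForm N x y = Matrix.trace (x.1 * y.1) := rfl

theorem trForm_comm (x y : Sl N) : trForm N x y = trForm N y x :=
  Matrix.trace_mul_comm x.1 y.1

theorem trForm_unitSl (x : Sl N) (a b : Fin N) : trForm N x (unitSl a b) = x.1 b a := by
  have hx : Matrix.trace x.1 = 0 := x.2
  rw [trForm_apply, unitSl, toSl, mul_sub, Matrix.trace_sub, Matrix.mul_smul, mul_one,
    Matrix.trace_smul, hx, smul_zero, sub_zero, Matrix.trace_mul_single, MulOpposite.op_one,
    one_smul]

theorem eq_zero_of_trForm {x : Sl N} (h : ∀ y, trForm N x y = 0) : x = 0 :=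
  sl_ext fun a b => by rw [← trForm_unitSl, h]; rfl

theorem trForm_adSl (g : GL (Fin N) ℂ) (x y : Sl N) :
    trForm N (adSl g x) (adSl g y) = trForm N x y := by
  rw [trForm_apply, trForm_apply, adSl_coe, adSl_coe, Matrix.trace_mul_comm]
  simp only [mul_assoc, Units.inv_mul_cancel_left]
  rw [Matrix.trace_mul_comm]
  simp only [mul_assoc, Units.inv_mul, mul_one]
  exact Matrix.trace_mul_comm _ _

theorem trace_mulLeft_mulRight (a b : Mat N) :
    LinearMap.trace ℂ (Mat N) (LinearMap.mulLeft ℂ a ∘ₗ LinearMap.mulRight ℂ b) =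
      a.trace * b.trace := by
  rw [LinearMap.trace_eq_matrix_trace ℂ (Matrix.stdBasis ℂ (Fin N) (Fin N)), Matrix.trace,
    Fintype.sum_prod_type, Matrix.trace, Matrix.trace, Finset.sum_mul_sum]
  refine Finset.sum_congr rfl fun i _ => Finset.sum_congr rfl fun j _ => ?_
  rw [Matrix.diag_apply, LinearMap.toMatrix_apply, Matrix.stdBasis_eq_single]
  simp [Matrix.stdBasis, Matrix.mul_apply, Matrix.single_apply, ite_and]

/-- On `𝔰𝔩_N` the Killing form is `2N tr(xy)`. The trace of `ad x ∘ ad y` is computed on the space of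
all matrices, which `ad x ∘ ad y` maps to `𝔰𝔩_N`. -/
theorem killingForm_eq_trForm (x y : Sl N) :
    killingForm ℂ (Sl N) x y = 2 * N * trForm N x y := by
  have hx : Matrix.trace x.1 = 0 := x.2
  have hy : Matrix.trace y.1 = 0 := y.2
  let F : Mat N →ₗ[ℂ] Mat N :=
    LinearMap.mulLeft ℂ (x.1 * y.1) ∘ₗ LinearMap.mulRight ℂ 1 -
    LinearMap.mulLeft ℂ x.1 ∘ₗ LinearMap.mulRight ℂ y.1 -
    LinearMap.mulLeft ℂ y.1 ∘ₗ LinearMap.mulRight ℂ x.1 +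
    LinearMap.mulLeft ℂ 1 ∘ₗ LinearMap.mulRight ℂ (y.1 * x.1)
  have hF : ∀ z, F z = x.1 * (y.1 * z - z * y.1) - (y.1 * z - z * y.1) * x.1 := by
    intro z
    simp only [F, LinearMap.add_apply, LinearMap.sub_apply, LinearMap.comp_apply,
      LinearMap.mulLeft_apply, LinearMap.mulRight_apply]
    noncomm_ring
  have hmem : ∀ z, F z ∈ (LieAlgebra.SpecialLinear.sl (Fin N) ℂ).toSubmodule := by
    intro z
    rw [hF]
    change Matrix.trace (_ : Mat N) = 0
    rw [Matrix.trace_sub, Matrix.trace_mul_comm, sub_self]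
  have htr := LinearMap.trace_restrict_eq_of_forall_mem
    (LieAlgebra.SpecialLinear.sl (Fin N) ℂ).toSubmodule F hmem
  have hFtr : LinearMap.trace ℂ (Mat N) F = 2 * N * trForm N x y := by
    simp only [F, map_add, map_sub, trace_mulLeft_mulRight, hx, hy, Matrix.trace_one,
      Fintype.card_fin, trForm_apply, Matrix.trace_mul_comm y.1 x.1]
    ring
  rw [killingForm_apply_apply, ← hFtr, ← htr]
  congr 1
  ext1 z
  ext1
  exact (hF z.1).symm

theorem formQ_apply (w z : Sl N × Sl N) :
    formQ N w z = 2 * N * (trForm N w.1 z.1 - trForm N w.2 z.2) := by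
  rw [mul_sub, ← killingForm_eq_trForm, ← killingForm_eq_trForm]; rfl

theorem orthogonal_adGraph (hN : N ≠ 0) (g : GL (Fin N) ℂ) :
    (formQ N).orthogonal (adGraph g) = adGraph g := by
  have hN' : (2 * N : ℂ) ≠ 0 := by simp [hN]
  ext w
  rw [LinearMap.BilinForm.mem_orthogonal_iff]
  constructor
  · intro h
    rw [mem_adGraph_iff, ← sub_eq_zero]
    refine eq_zero_of_trForm fun y => ?_
    obtain ⟨x, rfl⟩ := (adSl g).surjective y
    have : formQ N (x, adSl g x) w = 0 := h _ (mem_adGraph_iff.2 rfl)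
    rw [formQ_apply, mul_eq_zero, or_iff_right hN',
      sub_eq_zero] at this
    change trForm N _ (adSl g x) = 0
    rw [map_sub, LinearMap.sub_apply, trForm_adSl, trForm_comm, ← this, trForm_comm, sub_self]
  · intro h z hz
    rw [mem_adGraph_iff] at h hz
    rw [formQ_apply, h, hz, trForm_adSl, sub_self, mul_zero]

/-! ### The Casimir tensor -/

/-- The split Casimir tensor `Ω = Ω₊ + Ω₋` of `𝔰𝔩_N` for the trace form. -/
def omega (N : ℕ) : Sl N ⊗[ℂ] Sl N := omegaPlus N + omegaMinus N

theorem omega_eq_sum (N : ℕ) :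
    omega N = ∑ a : Fin N, ∑ b : Fin N, unitSl a b ⊗ₜ[ℂ] unitSl b a := by
  have hdiag : ∑ a : Fin N, unitSl a a ⊗ₜ[ℂ] unitSl a a = ∑ a : Fin N, ∑ b : Fin N,
      if a = b then unitSl a b ⊗ₜ[ℂ] unitSl b a else 0 := by
    simp
  have hlow : (∑ a : Fin N, ∑ b : Fin N, if a < b then unitSl b a ⊗ₜ[ℂ] unitSl a b else 0) =
      ∑ a : Fin N, ∑ b : Fin N, if b < a then unitSl a b ⊗ₜ[ℂ] unitSl b a else 0 :=
    Finset.sum_comm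
  rw [omega, omegaPlus, omegaMinus, add_add_add_comm, ← add_smul, hlow, hdiag]
  norm_num only
  rw [one_smul]
  simp only [← Finset.sum_add_distrib]
  refine Finset.sum_congr rfl fun a _ => Finset.sum_congr rfl fun b _ => ?_
  rcases lt_trichotomy a b with h | h | h
  · simp [h, h.ne, h.not_gt]
  · simp [h]
  · simp [h, h.ne', h.not_gt]

theorem comm_omega (N : ℕ) : TensorProduct.comm ℂ (Sl N) (Sl N) (omega N) = omega N := by
  simp only [omega_eq_sum, map_sum, TensorProduct.comm_tmul]
  exact Finset.sum_comm

theorem contract_tmul (ξ : Module.Dual ℂ (Sl N)) (x y : Sl N) :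
    contract ξ (x ⊗ₜ[ℂ] y) = ξ y • x := by
  simp [contract]

/-- `contract` as a linear map in the tensor. -/
def contractHom (ξ : Module.Dual ℂ (Sl N)) : Sl N ⊗[ℂ] Sl N →ₗ[ℂ] Sl N :=
  (TensorProduct.rid ℂ (Sl N)).toLinearMap ∘ₗ LinearMap.lTensor (Sl N) ξ

theorem contractHom_apply (ξ : Module.Dual ℂ (Sl N)) (t : Sl N ⊗[ℂ] Sl N) :
    contractHom ξ t = contract ξ t := rfl

theorem toSl_coe (x : Sl N) : toSl x.1 = x := by
  have hx : Matrix.trace x.1 = 0 := x.2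
  ext1
  simp [toSl, hx]

/-- `toSl` as a linear map. -/
def toSlHom (N : ℕ) : Mat N →ₗ[ℂ] Sl N where
  toFun := toSl
  map_add' x y := by
    ext1
    simp only [toSl, Matrix.trace_add, add_div, add_smul]
    exact add_sub_add_comm _ _ _ _
  map_smul' c x := by
    ext1
    simp [toSl, Matrix.trace_smul, mul_div_assoc, smul_sub, mul_smul]

theorem sum_smul_unitSl (x : Sl N) :
    ∑ a : Fin N, ∑ b : Fin N, x.1 a b • unitSl a b = x := by
  conv_rhs => rw [← toSl_coe x, Matrix.matrix_eq_sum_single x.1]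
  change _ = toSlHom N _
  simp only [map_sum]
  refine Finset.sum_congr rfl fun a _ => Finset.sum_congr rfl fun b _ => ?_
  rw [unitSl]
  change x.1 a b • toSlHom N _ = _
  rw [← map_smul, Matrix.smul_single, smul_eq_mul, mul_one]

theorem contract_trForm_omega (x : Sl N) : contract (trForm N x) (omega N) = x := by
  rw [← contractHom_apply, omega_eq_sum]
  simp only [map_sum, contractHom_apply, contract_tmul, trForm_unitSl]
  exact sum_smul_unitSl x

theorem trForm_surjective (N : ℕ) : Function.Surjective (trForm N) := by
  refine (LinearMap.injective_iff_surjective_of_finrank_eq_finrank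
    (Subspace.dual_finrank_eq (K := ℂ) (V := Sl N)).symm).1 ?_
  rw [injective_iff_map_eq_zero]
  intro x hx
  exact eq_zero_of_trForm fun y => by rw [hx]; rfl

/-- A tensor is determined by its contractions in the second factor. -/
theorem eq_of_forall_rid_lTensor {M B : Type*} [AddCommGroup M] [Module ℂ M] [AddCommGroup B]
    [Module ℂ B] {s t : M ⊗[ℂ] B} (h : ∀ β : Module.Dual ℂ B,
      TensorProduct.rid ℂ M (LinearMap.lTensor M β s) =
        TensorProduct.rid ℂ M (LinearMap.lTensor M β t)) : s = t := by
  classical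
  let b := Module.Basis.ofVectorSpace ℂ B
  refine (TensorProduct.equivFinsuppOfBasisRight b).injective ?_
  have key : ∀ (r : M ⊗[ℂ] B) k, TensorProduct.equivFinsuppOfBasisRight b r k =
      TensorProduct.rid ℂ M (LinearMap.lTensor M (b.coord k) r) := by
    intro r k
    induction r with
    | zero => simp
    | tmul x y => simp
    | add r s hr hs => simp only [map_add, Finsupp.add_apply, hr, hs]
  ext1 k
  rw [key, key, h]

theorem tensor_ext {s t : Sl N ⊗[ℂ] Sl N} (h : ∀ ξ, contract ξ s = contract ξ t) : s = t :=
  eq_of_forall_rid_lTensor h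

theorem contract_rTensor (ξ : Module.Dual ℂ (Sl N)) (T : Sl N →ₗ[ℂ] Sl N)
    (t : Sl N ⊗[ℂ] Sl N) : contract ξ (LinearMap.rTensor (Sl N) T t) = T (contract ξ t) := by
  simp only [← contractHom_apply]
  induction t with
  | zero => simp
  | tmul x y => simp [contractHom_apply, contract_tmul]
  | add r s hr hs => simp only [map_add, hr, hs]

theorem contract_lTensor (ξ : Module.Dual ℂ (Sl N)) (T : Sl N →ₗ[ℂ] Sl N)
    (t : Sl N ⊗[ℂ] Sl N) :
    contract ξ (LinearMap.lTensor (Sl N) T t) = contract (ξ ∘ₗ T) t := by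
  simp only [← contractHom_apply]
  induction t with
  | zero => simp
  | tmul x y => simp [contractHom_apply, contract_tmul]
  | add r s hr hs => simp only [map_add, hr, hs]

/-- Transposing `(T ⊗ 1) Ω` amounts to taking the adjoint of `T` for the trace form. -/
theorem comm_rTensor_omega {S T : Sl N →ₗ[ℂ] Sl N}
    (h : ∀ x y, trForm N (S x) y = trForm N x (T y)) :
    TensorProduct.comm ℂ (Sl N) (Sl N) (LinearMap.rTensor (Sl N) T (omega N)) =
      LinearMap.rTensor (Sl N) S (omega N) := by
  have hcomm : ∀ t, TensorProduct.comm ℂ (Sl N) (Sl N) (LinearMap.rTensor (Sl N) T t) =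
      LinearMap.lTensor (Sl N) T (TensorProduct.comm ℂ (Sl N) (Sl N) t) := by
    intro t
    induction t with
    | zero => simp
    | tmul x y => simp
    | add r s hr hs => simp only [map_add, hr, hs]
  rw [hcomm, comm_omega]
  refine tensor_ext fun ξ => ?_
  obtain ⟨x, rfl⟩ := trForm_surjective N ξ
  have : trForm N x ∘ₗ T = trForm N (S x) := LinearMap.ext fun y => (h x y).symm
  rw [contract_lTensor, contract_rTensor, contract_trForm_omega, this, contract_trForm_omega]

/-! ### The operators of a transversal graph -/

theorem leviPart_add_upperPart_of_lowerPart_eq_zero {x : Sl N} (h : lowerPart N i x = 0) :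
    leviPart N i x + upperPart N i x = x := by
  simp [leviPart, h]

theorem trForm_add_of_blocks (N i : ℕ) (x y : Sl N) :
    trForm N x y = trForm N (leviPart N i x) (leviPart N i y) +
      trForm N (upperPart N i x) (lowerPart N i y) +
      trForm N (lowerPart N i x) (upperPart N i y) := by
  simp only [trForm_apply, Matrix.trace, Matrix.diag_apply, Matrix.mul_apply, leviPart_apply,
    upperPart_apply, lowerPart_apply, ← Finset.sum_add_distrib]
  refine Finset.sum_congr rfl fun a _ => Finset.sum_congr rfl fun b _ => ?_
  split_ifs <;> first | omega | simp

theorem leviPart_leviPart (x : Sl N) : leviPart N i (leviPart N i x) = leviPart N i x :=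
  sl_ext fun a b => by simp only [leviPart_apply]; split_ifs <;> rfl

theorem leviPart_upperPart (x : Sl N) : leviPart N i (upperPart N i x) = 0 :=
  sl_ext fun a b => by
    change _ = (0 : ℂ)
    simp only [leviPart_apply, upperPart_apply]; split_ifs <;> first | omega | rfl

theorem leviPart_lowerPart (x : Sl N) : leviPart N i (lowerPart N i x) = 0 :=
  sl_ext fun a b => by
    change _ = (0 : ℂ)
    simp only [leviPart_apply, lowerPart_apply]; split_ifs <;> first | omega | rfl

theorem upperPart_leviPart (x : Sl N) : upperPart N i (leviPart N i x) = 0 :=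
  sl_ext fun a b => by
    change _ = (0 : ℂ)
    simp only [leviPart_apply, upperPart_apply]; split_ifs <;> first | omega | rfl

theorem upperPart_upperPart (x : Sl N) : upperPart N i (upperPart N i x) = upperPart N i x :=
  sl_ext fun a b => by simp only [upperPart_apply]; split_ifs <;> rfl

theorem upperPart_lowerPart (x : Sl N) : upperPart N i (lowerPart N i x) = 0 :=
  sl_ext fun a b => by
    change _ = (0 : ℂ)
    simp only [lowerPart_apply, upperPart_apply]; split_ifs <;> first | omega | rfl

theorem lowerPart_leviPart (x : Sl N) : lowerPart N i (leviPart N i x) = 0 :=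
  sl_ext fun a b => by
    change _ = (0 : ℂ)
    simp only [leviPart_apply, lowerPart_apply]; split_ifs <;> first | omega | rfl

theorem lowerPart_upperPart (x : Sl N) : lowerPart N i (upperPart N i x) = 0 :=
  sl_ext fun a b => by
    change _ = (0 : ℂ)
    simp only [lowerPart_apply, upperPart_apply]; split_ifs <;> first | omega | rfl

theorem lowerPart_lowerPart (x : Sl N) : lowerPart N i (lowerPart N i x) = lowerPart N i x :=
  sl_ext fun a b => by simp only [lowerPart_apply]; split_ifs <;> rfl

variable {g : GL (Fin N) ℂ}

/-- The projection of `𝔰𝔩_N ⊕ 𝔰𝔩_N` onto `(P_i, P_i, id)` along a transversal graph. -/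
def parabolicProj (h : IsCompl (adGraph g) (parabolicTriple N i)) :
    Sl N × Sl N →ₗ[ℂ] Sl N × Sl N :=
  (parabolicTriple N i).projection (adGraph g) h.symm

/-- The value at `u = 0` of the element of `𝔤[u]` that represents `w` modulo the graph: the second
component of the projection of `w` onto `(P_i, P_i, id)`. -/
def constTerm (h : IsCompl (adGraph g) (parabolicTriple N i)) : Sl N × Sl N →ₗ[ℂ] Sl N :=
  LinearMap.snd ℂ (Sl N) (Sl N) ∘ₗ parabolicProj h

/-- The coefficient at `u` of the element of `𝔤[u]` that represents `w` modulo the graph: the upper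
right block of the first component of the projection of `w` onto `(P_i, P_i, id)`. -/
def linTerm (h : IsCompl (adGraph g) (parabolicTriple N i)) : Sl N × Sl N →ₗ[ℂ] Sl N :=
  upperPart N i ∘ₗ LinearMap.fst ℂ (Sl N) (Sl N) ∘ₗ parabolicProj h

theorem lowerPart_constTerm (h : IsCompl (adGraph g) (parabolicTriple N i)) (w : Sl N × Sl N) :
    lowerPart N i (constTerm h w) = 0 :=
  ((mem_parabolicTriple_iff _).1 (Submodule.projection_apply_mem h.symm w)).2.1

theorem upperPart_linTerm (h : IsCompl (adGraph g) (parabolicTriple N i)) (w : Sl N × Sl N) :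
    upperPart N i (linTerm h w) = linTerm h w :=
  upperPart_upperPart _

theorem leviPart_linTerm (h : IsCompl (adGraph g) (parabolicTriple N i)) (w : Sl N × Sl N) :
    leviPart N i (linTerm h w) = 0 :=
  leviPart_upperPart _

theorem lowerPart_linTerm (h : IsCompl (adGraph g) (parabolicTriple N i)) (w : Sl N × Sl N) :
    lowerPart N i (linTerm h w) = 0 :=
  lowerPart_upperPart _

theorem constTerm_sub_mem_adGraph (h : IsCompl (adGraph g) (parabolicTriple N i))
    (w : Sl N × Sl N) :
    (leviPart N i (constTerm h w) - w.1 + linTerm h w, constTerm h w - w.2) ∈ adGraph g := by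
  have hP : parabolicProj h w ∈ parabolicTriple N i := Submodule.projection_apply_mem h.symm w
  have hW : w - parabolicProj h w ∈ adGraph g := Submodule.sub_projection_mem h.symm w
  simp only [constTerm, linTerm, LinearMap.comp_apply, LinearMap.fst_apply, LinearMap.snd_apply]
  generalize parabolicProj h w = z at hP hW ⊢
  rw [mem_parabolicTriple_iff] at hP
  have e := leviPart_add_upperPart_of_lowerPart_eq_zero hP.1
  rw [hP.2.2] at e
  have e' : leviPart N i z.2 - w.1 + upperPart N i z.1 = z.1 - w.1 := by
    nth_rewrite 2 [← e]
    abel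
  rw [e']
  have := Submodule.neg_mem _ hW
  rwa [neg_sub] at this

/-- The graph is isotropic. -/
theorem trForm_eq_of_mem_adGraph {w z : Sl N × Sl N} (hw : w ∈ adGraph g) (hz : z ∈ adGraph g) :
    trForm N w.1 z.1 = trForm N w.2 z.2 := by
  rw [mem_adGraph_iff] at hw hz
  rw [hw, hz, trForm_adSl]

/-- The sum `(0, x) + v (-lowerPart x, 0)`. If `ξ = tr(x ·)`, then the coefficients of `(id ⊗ ξ) X` at
`1` and `v` lie in the lift of the graph exactly if the regular part of `X` represents `(0, x)` and
`(-lowerPart x, 0)`, respectively, modulo the graph; the other coefficients contribute nothing. -/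
def seed (N i : ℕ) (v : ℂ) : Sl N →ₗ[ℂ] Sl N × Sl N :=
  LinearMap.inr ℂ (Sl N) (Sl N) - v • (LinearMap.inl ℂ (Sl N) (Sl N) ∘ₗ lowerPart N i)

theorem seed_apply (v : ℂ) (x : Sl N) : seed N i v x = (-(v • lowerPart N i x), x) := by
  simp [seed]

theorem seed_mem_adGraph (h : IsCompl (adGraph g) (parabolicTriple N i)) (v : ℂ) (x : Sl N) :
    (leviPart N i (constTerm h (seed N i v x)) + v • lowerPart N i x +
      linTerm h (seed N i v x), constTerm h (seed N i v x) - x) ∈ adGraph g := by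
  have := constTerm_sub_mem_adGraph h (seed N i v x)
  rw [seed_apply, sub_neg_eq_add] at this
  rwa [seed_apply]

/-- The operator version of unitarity. It says that the graph is isotropic on the pairs of
`seed_mem_adGraph` for the values `v` and `u` of the second variable. -/
theorem trForm_constTerm_add_linTerm (h : IsCompl (adGraph g) (parabolicTriple N i)) (u v : ℂ)
    (x y : Sl N) :
    trForm N (constTerm h (seed N i v x) + u • linTerm h (seed N i v x)) y +
      trForm N x (constTerm h (seed N i u y) + v • linTerm h (seed N i u y)) = trForm N x y := by
  have key := trForm_eq_of_mem_adGraph (seed_mem_adGraph h v x) (seed_mem_adGraph h u y)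
  dsimp only at key
  generalize hc : constTerm h (seed N i v x) = c at key ⊢
  generalize hl : linTerm h (seed N i v x) = l at key ⊢
  generalize hc' : constTerm h (seed N i u y) = c' at key ⊢
  generalize hl' : linTerm h (seed N i u y) = l' at key ⊢
  have h1 : lowerPart N i c = 0 := hc ▸ lowerPart_constTerm h _
  have h2 : lowerPart N i c' = 0 := hc' ▸ lowerPart_constTerm h _
  have h3 : upperPart N i l = l := hl ▸ upperPart_linTerm h _
  have h4 : upperPart N i l' = l' := hl' ▸ upperPart_linTerm h _
  have h5 : lowerPart N i l = 0 := hl ▸ lowerPart_linTerm h _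
  have h6 : lowerPart N i l' = 0 := hl' ▸ lowerPart_linTerm h _
  have h7 : leviPart N i l = 0 := hl ▸ leviPart_linTerm h _
  have h8 : leviPart N i l' = 0 := hl' ▸ leviPart_linTerm h _
  have ecc := trForm_add_of_blocks N i c c'
  have ely := trForm_add_of_blocks N i l y
  have exl := trForm_add_of_blocks N i x l'
  rw [trForm_add_of_blocks N i] at key
  simp only [map_add, map_smul, map_sub, LinearMap.add_apply, LinearMap.smul_apply,
    LinearMap.sub_apply, h1, h2, h3, h4, h5, h6, h7, h8, leviPart_leviPart, leviPart_lowerPart,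
    upperPart_leviPart, upperPart_lowerPart, lowerPart_leviPart, lowerPart_lowerPart,
    map_zero, LinearMap.zero_apply, smul_zero, add_zero, zero_add, smul_eq_mul] at key ecc ely exl ⊢
  rw [ely, exl]
  linear_combination key + ecc

/-! ### Laurent coefficients -/

/-- The exponent of `u` in the entry of `D` at `(a, a)`. -/
def gaugeExp (i : ℕ) (a : Fin N) : ℤ := if (a : ℕ) < i then 0 else 1

theorem gaugeD_eq (N i : ℕ) :
    gaugeD N i = Matrix.diagonal fun a => HahnSeries.single (-gaugeExp i a) (1 : ℂ) := by
  rw [gaugeD]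
  congr 1
  funext a
  rw [gaugeExp]
  split_ifs
  · rw [neg_zero]; rfl
  · rfl

theorem gauge_eq_iff (A F : LoopMat N) :
    gaugeD N i * A = F * gaugeD N i ↔
      ∀ a b n, (A a b).coeff (n + gaugeExp i a - gaugeExp i b) = (F a b).coeff n := by
  rw [gaugeD_eq, ← Matrix.ext_iff]
  simp only [Matrix.diagonal_mul, Matrix.mul_diagonal]
  refine forall_congr' fun a => forall_congr' fun b => ?_
  constructor
  · intro h n
    have := congrArg (fun s => HahnSeries.coeff s (n - gaugeExp i b)) h
    simp only [HahnSeries.coeff_single_mul, HahnSeries.coeff_mul_single, one_mul, mul_one] at this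
    rw [show n + gaugeExp i a - gaugeExp i b = n - gaugeExp i b - -gaugeExp i a by ring, this,
      show n - gaugeExp i b - -gaugeExp i b = n by ring]
  · intro h
    ext n
    simp only [HahnSeries.coeff_single_mul, HahnSeries.coeff_mul_single, one_mul, mul_one]
    rw [← h]
    congr 1; ring

theorem ofPowerSeries_coeff (f : PowerSeries ℂ) (n : ℤ) :
    (HahnSeries.ofPowerSeries ℤ ℂ f).coeff n =
      if n < 0 then 0 else PowerSeries.coeff n.natAbs f :=
  PowerSeries.coeff_coe f n

/-- Membership in the subalgebra attached to `W`, read off from the coefficients `c n` at `u⁻ⁿ`. -/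
theorem mem_loopLift_iff {W : Submodule ℂ (Sl N × Sl N)} {A : LoopMat N} {c : ℤ → Sl N}
    (hc : ∀ a b n, (A a b).coeff n = (c n).1 a b) (y : Sl N) :
    (A, y) ∈ loopLift i W ↔ (∀ n < -1, c n = 0) ∧ upperPart N i (c (-1)) = c (-1) ∧
      lowerPart N i (c 0) = 0 ∧
      (leviPart N i (c 0) + lowerPart N i (c 1) + c (-1), y) ∈ W := by
  have hlt : ∀ a : Fin N, (a : ℕ) < i → gaugeExp i a = 0 := fun a ha => if_pos ha
  have hge : ∀ a : Fin N, ¬(a : ℕ) < i → gaugeExp i a = 1 := fun a ha => if_neg ha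
  have hsum : upperPart N i (c (-1)) = c (-1) → ∀ a b,
      (leviPart N i (c 0) + lowerPart N i (c 1) + c (-1)).1 a b =
        (c (gaugeExp i a - gaugeExp i b)).1 a b := by
    intro h a b
    rw [← h]
    change (leviPart N i (c 0)).1 a b + (lowerPart N i (c 1)).1 a b +
      (upperPart N i (c (-1))).1 a b = _
    rw [leviPart_apply, lowerPart_apply, upperPart_apply]
    by_cases ha : (a : ℕ) < i <;> by_cases hb : (b : ℕ) < i <;>
      simp [ha, hb, hlt, hge, not_lt.1, Nat.not_le.2]
  constructor
  · rintro ⟨f, x, hx, hW, hf⟩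
    have h : ∀ a b (n : ℤ), (c (n + gaugeExp i a - gaugeExp i b)).1 a b =
        if n < 0 then 0 else PowerSeries.coeff n.natAbs (f.1 a b) := by
      intro a b n
      rw [← hc, (gauge_eq_iff _ _).1 hf, Matrix.map_apply, ofPowerSeries_coeff]
    have hneg : ∀ a b (n : ℤ), n < gaugeExp i a - gaugeExp i b → (c n).1 a b = 0 := by
      intro a b n hn
      have := h a b (n - (gaugeExp i a - gaugeExp i b))
      rw [if_pos (by omega)] at this
      rwa [show n - (gaugeExp i a - gaugeExp i b) + gaugeExp i a - gaugeExp i b = n by ring]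
        at this
    have hx' : ∀ a b, x.1 a b = (c (gaugeExp i a - gaugeExp i b)).1 a b := by
      intro a b
      have := h a b 0
      rw [if_neg (lt_irrefl _), zero_add] at this
      rw [this, hx, Matrix.map_apply, Int.natAbs_zero, PowerSeries.coeff_zero_eq_constantCoeff_apply]
    have hu : upperPart N i (c (-1)) = c (-1) := by
      refine sl_ext fun a b => ?_
      rw [upperPart_apply]
      split_ifs with hab
      · rfl
      · refine (hneg a b (-1) ?_).symm
        by_cases ha : (a : ℕ) < i <;> by_cases hb : (b : ℕ) < i <;>
          simp [ha, hb, hlt, hge]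
        omega
    refine ⟨fun n hn => sl_ext fun a b => hneg a b n ?_, hu, sl_ext fun a b => ?_, ?_⟩
    · by_cases ha : (a : ℕ) < i <;> by_cases hb : (b : ℕ) < i <;>
        simp only [ha, hb, hlt, hge, not_false_eq_true] <;> omega
    · change _ = (0 : ℂ)
      rw [lowerPart_apply]
      split_ifs with hab
      · refine hneg a b 0 ?_
        rw [hge a (by omega), hlt b (by omega)]; norm_num
      · rfl
    · convert hW using 2
      exact sl_ext fun a b => (hsum hu a b).trans (hx' a b).symm
  · rintro ⟨h1, hu, h0, hW⟩
    have hneg : ∀ a b (n : ℤ), n < gaugeExp i a - gaugeExp i b → (c n).1 a b = 0 := by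
      intro a b n hn
      have e1 : (upperPart N i (c (-1))).1 a b = (c (-1)).1 a b := by rw [hu]
      have e0 : (lowerPart N i (c 0)).1 a b = 0 := by rw [h0]; rfl
      rw [upperPart_apply] at e1
      rw [lowerPart_apply] at e0
      rcases lt_trichotomy n (-1) with hn1 | rfl | hn1
      · rw [h1 n hn1]; rfl
      · rw [← e1, if_neg]
        rintro ⟨ha, hb⟩
        rw [hlt a ha, hge b (by omega)] at hn
        omega
      · by_cases ha : (a : ℕ) < i
        · rw [hlt a ha] at hn
          by_cases hb : (b : ℕ) < i
          · rw [hlt b hb] at hn; omega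
          · rw [hge b hb] at hn; omega
        · by_cases hb : (b : ℕ) < i
          · rw [hge a ha, hlt b hb] at hn
            obtain rfl : n = 0 := by omega
            rwa [if_pos ⟨by omega, hb⟩] at e0
          · rw [hge a ha, hge b hb] at hn; omega
    let f : Matrix (Fin N) (Fin N) (PowerSeries ℂ) := Matrix.of fun a b =>
      PowerSeries.mk fun n => (c ((n : ℤ) + gaugeExp i a - gaugeExp i b)).1 a b
    have hf : ∀ a b (n : ℕ), PowerSeries.coeff n (f a b) =
        (c ((n : ℤ) + gaugeExp i a - gaugeExp i b)).1 a b :=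
      fun a b n => by simp only [f, Matrix.of_apply, PowerSeries.coeff_mk]
    have htr : f ∈ LieAlgebra.SpecialLinear.sl (Fin N) (PowerSeries ℂ) := by
      change Matrix.trace f = 0
      ext n
      have : Matrix.trace (c n).1 = 0 := (c n).2
      rw [Matrix.trace, map_sum, map_zero, ← this]
      refine Finset.sum_congr rfl fun a _ => ?_
      rw [Matrix.diag_apply, hf, add_sub_cancel_right]
      rfl
    refine ⟨⟨f, htr⟩, _, Matrix.ext fun a b => ?_, hW, (gauge_eq_iff _ _).2 fun a b n => ?_⟩
    · rw [hsum hu, Matrix.map_apply, ← PowerSeries.coeff_zero_eq_constantCoeff_apply, hf,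
        Nat.cast_zero, zero_add]
    · rw [Matrix.map_apply, ofPowerSeries_coeff, hc]
      split_ifs with hn
      · exact hneg a b _ (by omega)
      · rw [hf, Int.natAbs_of_nonneg (by omega)]

/-- The coefficient of `coeffAtInfty p k ξ` at `u⁻ⁿ`. -/
def laurentCoeff (p : TensorPoly N) (k : ℕ) (ξ : Module.Dual ℂ (Sl N)) (n : ℤ) : Sl N :=
  (if k = 0 then if n = 0 then contract ξ (omegaPlus N) else 0
    else if n = k then contract ξ (omega N) else 0) +
  if n ≤ 0 then contract ξ (p (n.natAbs, k)) else 0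

theorem uPow_smul_constLoop_coeff (m : ℤ) (x : Sl N) (a b : Fin N) (n : ℤ) :
    ((uPow m • constLoop x) a b).coeff n = if n = -m then x.1 a b else 0 := by
  rw [Matrix.smul_apply, constLoop, Matrix.map_apply, smul_eq_mul, uPow,
    HahnSeries.coeff_single_mul, one_mul, HahnSeries.C_apply, HahnSeries.coeff_single]
  simp [sub_neg_eq_add, eq_neg_iff_add_eq_zero]

theorem constLoop_coeff (x : Sl N) (a b : Fin N) (n : ℤ) :
    (constLoop x a b).coeff n = if n = 0 then x.1 a b else 0 := by
  have := uPow_smul_constLoop_coeff 0 x a b n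
  rwa [uPow, neg_zero, show HahnSeries.single (0 : ℤ) (1 : ℂ) = 1 from rfl, one_smul] at this

theorem uPow_smul_constLoop_add (m : ℤ) (x y : Sl N) :
    uPow m • constLoop (x + y) = uPow m • constLoop x + uPow m • constLoop y := by
  refine Matrix.ext fun a b => HahnSeries.ext (funext fun n => ?_)
  rw [Matrix.add_apply, HahnSeries.coeff_add, uPow_smul_constLoop_coeff,
    uPow_smul_constLoop_coeff, uPow_smul_constLoop_coeff]
  split_ifs
  · rfl
  · rw [add_zero]

theorem uPow_smul_constLoop_zero (m : ℤ) : uPow m • constLoop (0 : Sl N) = 0 := by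
  refine Matrix.ext fun a b => HahnSeries.ext (funext fun n => ?_)
  rw [uPow_smul_constLoop_coeff]
  exact ite_self _

theorem sum_uPow_coeff (p : TensorPoly N) (k : ℕ) (ξ : Module.Dual ℂ (Sl N)) (a b : Fin N)
    (n : ℤ) :
    (((p.sum fun m c => if m.2 = k then uPow (m.1 : ℤ) • constLoop (contract ξ c) else 0) :
      LoopMat N) a b).coeff n =
      (if n ≤ 0 then contract ξ (p (n.natAbs, k)) else 0 : Sl N).1 a b := by
  induction p using Finsupp.induction_linear with
  | zero =>
    rw [Finsupp.sum_zero_index, Finsupp.zero_apply, ← contractHom_apply, map_zero, ite_self]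
    rfl
  | add p q hp hq =>
    rw [Finsupp.sum_add_index', Matrix.add_apply, HahnSeries.coeff_add, hp, hq, Finsupp.add_apply]
    · simp only [← contractHom_apply, map_add]
      split_ifs
      · rfl
      · exact add_zero 0
    · intro m
      rw [← contractHom_apply, map_zero, uPow_smul_constLoop_zero, ite_self]
    · intro m c c'
      rw [← contractHom_apply, map_add, uPow_smul_constLoop_add]
      simp only [contractHom_apply]
      split_ifs
      · rfl
      · rw [add_zero]
  | single m c =>
    rw [Finsupp.sum_single_index]
    · obtain ⟨m, l⟩ := m
      dsimp only
      by_cases hl : l = k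
      · rw [if_pos hl, uPow_smul_constLoop_coeff]
        by_cases hn : n = -m
        · rw [if_pos hn, if_pos (by omega), Finsupp.single_apply, if_pos]
          rw [hl, hn, Int.natAbs_neg, Int.natAbs_natCast]
        · rw [if_neg hn]
          split_ifs with h0
          · rw [Finsupp.single_apply, if_neg, ← contractHom_apply, map_zero]
            · rfl
            · intro h
              have := congrArg Prod.fst h
              dsimp only at this
              omega
          · rfl
      · have h0 : (Finsupp.single (m, l) c : TensorPoly N) (n.natAbs, k) = 0 :=
          Finsupp.single_eq_of_ne' fun h => hl (congrArg Prod.snd h)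
        rw [if_neg hl, h0, ← contractHom_apply, map_zero, ite_self]
        rfl
    · rw [← contractHom_apply, map_zero, uPow_smul_constLoop_zero, ite_self]

theorem coeffAtInfty_coeff (p : TensorPoly N) (k : ℕ) (ξ : Module.Dual ℂ (Sl N)) (a b : Fin N)
    (n : ℤ) : (coeffAtInfty p k ξ a b).coeff n = (laurentCoeff p k ξ n).1 a b := by
  rw [coeffAtInfty, Matrix.add_apply, HahnSeries.coeff_add, sum_uPow_coeff]
  change _ = (ite _ _ _ : Sl N).1 a b + _
  congr 1
  by_cases hk : k = 0
  · rw [if_pos hk, if_pos hk, constLoop_coeff]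
    split_ifs <;> rfl
  · rw [if_neg hk, if_neg hk, uPow_smul_constLoop_coeff, neg_neg]
    split_ifs <;> rfl

/-- The coefficient at `vᵏ` of the part of `X` that is regular at `u = v` and constant in `u`,
contracted with `ξ`. -/
def constCoeff (p : TensorPoly N) (k : ℕ) (ξ : Module.Dual ℂ (Sl N)) : Sl N :=
  contract ξ (p (0, k)) + if k = 0 then contract ξ (omegaPlus N) else 0

/-- `X` is defined by `W` if and only if `p` has degree at most one in `u`, the coefficients at `u`
lie in the upper right block, those at `1` are block upper triangular, and for each power of `v` one
pair, formed by the limit at `u = ∞` of the conjugate by `D` and the value at `u = 0`, lies in `W`. -/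
theorem isDefinedBy_iff (p : TensorPoly N) (W : Submodule ℂ (Sl N × Sl N)) :
    IsDefinedBy i p W ↔ ∀ (k : ℕ) (ξ : Module.Dual ℂ (Sl N)),
      (∀ m, 1 < m → contract ξ (p (m, k)) = 0) ∧
      upperPart N i (contract ξ (p (1, k))) = contract ξ (p (1, k)) ∧
      lowerPart N i (constCoeff p k ξ) = 0 ∧
      (leviPart N i (constCoeff p k ξ) +
        (if k = 1 then lowerPart N i (contract ξ (omega N)) else 0) + contract ξ (p (1, k)),
        constCoeff p k ξ - if k = 0 then contract ξ (omega N) else 0) ∈ W := by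
  refine forall_congr' fun k => forall_congr' fun ξ => ?_
  rw [mem_loopLift_iff (coeffAtInfty_coeff p k ξ)]
  have hneg : ∀ m : ℕ, 0 < m → laurentCoeff p k ξ (-m) = contract ξ (p (m, k)) := by
    intro m hm
    rw [laurentCoeff, if_neg (show ¬(-(m : ℤ) = 0) by omega),
      if_neg (show ¬(-(m : ℤ) = k) by omega), ite_self, zero_add,
      if_pos (show -(m : ℤ) ≤ 0 by omega), Int.natAbs_neg, Int.natAbs_natCast]
  have hneg1 : laurentCoeff p k ξ (-1) = contract ξ (p (1, k)) := hneg 1 one_pos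
  have hzero : laurentCoeff p k ξ 0 = constCoeff p k ξ := by
    rw [laurentCoeff, constCoeff, if_pos rfl, if_pos le_rfl, Int.natAbs_zero, add_comm]
    congr 1
    by_cases hk : k = 0
    · rw [if_pos hk, if_pos hk]
    · rw [if_neg hk, if_neg hk, if_neg (by omega)]
  have hone : lowerPart N i (laurentCoeff p k ξ 1) =
      if k = 1 then lowerPart N i (contract ξ (omega N)) else 0 := by
    rw [laurentCoeff, if_neg (show ¬((1 : ℤ) = 0) by omega),
      if_neg (show ¬((1 : ℤ) ≤ 0) by omega), add_zero]
    by_cases hk : k = 1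
    · rw [if_neg (by omega), if_pos (by omega), if_pos hk]
    · rw [if_neg hk, if_neg (show ¬((1 : ℤ) = k) by omega), ite_self, map_zero]
  have hsnd : coeffAtZero p k ξ =
      constCoeff p k ξ - if k = 0 then contract ξ (omega N) else 0 := by
    rw [coeffAtZero, constCoeff]
    split_ifs
    · rw [omega]
      simp only [← contractHom_apply, map_add]
      abel
    · abel
  rw [hneg1, hzero, hone, hsnd]
  refine and_congr_left fun _ => ⟨fun h m hm => ?_, fun h n hn => ?_⟩
  · rw [← hneg m (by omega)]
    exact h _ (by omega)
  · have := hneg n.natAbs (by omega)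
    rw [show -(n.natAbs : ℤ) = n by omega] at this
    rw [this]
    exact h _ (by omega)

/-! ### The polynomial attached to a transversal graph -/

theorem isDefinedBy_unique (h : IsCompl (adGraph g) (parabolicTriple N i)) {p p' : TensorPoly N}
    (hp : IsDefinedBy i p (adGraph g)) (hp' : IsDefinedBy i p' (adGraph g)) : p' = p := by
  rw [isDefinedBy_iff] at hp hp'
  have key : ∀ k ξ, contract ξ (p' (0, k)) = contract ξ (p (0, k)) ∧
      contract ξ (p' (1, k)) = contract ξ (p (1, k)) := by
    intro k ξ
    obtain ⟨-, h1, h0, hW⟩ := hp k ξ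
    obtain ⟨-, h1', h0', hW'⟩ := hp' k ξ
    have hd := Submodule.sub_mem _ hW' hW
    rw [Prod.mk_sub_mk, add_sub_add_comm, add_sub_add_right_eq_sub, sub_sub_sub_cancel_right,
      ← map_sub] at hd
    have hc : constCoeff p' k ξ - constCoeff p k ξ =
        contract ξ (p' (0, k)) - contract ξ (p (0, k)) := by
      rw [constCoeff, constCoeff, add_sub_add_right_eq_sub]
    have hlow : lowerPart N i (constCoeff p' k ξ - constCoeff p k ξ) = 0 := by
      rw [map_sub, h0, h0', sub_zero]
    have hup : upperPart N i (contract ξ (p' (1, k)) - contract ξ (p (1, k))) =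
        contract ξ (p' (1, k)) - contract ξ (p (1, k)) := by
      rw [map_sub, h1, h1']
    have hP : (leviPart N i (constCoeff p' k ξ - constCoeff p k ξ) +
        (contract ξ (p' (1, k)) - contract ξ (p (1, k))),
        constCoeff p' k ξ - constCoeff p k ξ) ∈ parabolicTriple N i := by
      rw [mem_parabolicTriple_iff]
      refine ⟨?_, hlow, ?_⟩
      · rw [map_add, lowerPart_leviPart, ← hup, lowerPart_upperPart, add_zero]
      · rw [map_add, leviPart_leviPart, ← hup, leviPart_upperPart, add_zero]
    have hz := Submodule.disjoint_def.1 h.disjoint _ hd hP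
    rw [Prod.mk_eq_zero, hc] at hz
    obtain ⟨hz1, hz2⟩ := hz
    rw [hz2, map_zero, zero_add] at hz1
    exact ⟨sub_eq_zero.1 hz2, sub_eq_zero.1 hz1⟩
  ext1 m
  obtain ⟨m, k⟩ := m
  refine tensor_ext fun ξ => ?_
  match m with
  | 0 => exact (key k ξ).1
  | 1 => exact (key k ξ).2
  | m + 2 => rw [(hp k ξ).1 _ (by omega), (hp' k ξ).1 _ (by omega)]

/-- Already the coefficient `Ω v/u` at `v` makes a nonzero `p` necessary. -/
theorem ne_zero_of_isDefinedBy (hi : 0 < i) (hiN : i < N) {p : TensorPoly N}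
    (hp : IsDefinedBy i p (adGraph g)) : p ≠ 0 := by
  rintro rfl
  rw [isDefinedBy_iff] at hp
  let a : Fin N := ⟨0, by omega⟩
  let b : Fin N := ⟨i, hiN⟩
  obtain ⟨-, -, -, hW⟩ := hp 1 (trForm N (unitSl b a))
  have hc : constCoeff (0 : TensorPoly N) 1 (trForm N (unitSl b a)) = 0 := by
    rw [constCoeff, if_neg one_ne_zero, Finsupp.zero_apply, ← contractHom_apply, map_zero, add_zero]
  rw [hc, map_zero, zero_add, if_pos rfl, if_neg one_ne_zero, sub_zero, contract_trForm_omega,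
    Finsupp.zero_apply, ← contractHom_apply, map_zero, add_zero, mem_adGraph_iff] at hW
  have h0 : lowerPart N i (unitSl b a) = 0 := by
    rw [← (adSl g).injective.eq_iff]
    exact hW.symm.trans (map_zero (adSl g)).symm
  have h1 : (lowerPart N i (unitSl b a)).1 b a = 0 := by rw [h0]; rfl
  have hba : b ≠ a := fun e => hi.ne' (congrArg Fin.val e)
  rw [lowerPart_apply, if_pos ⟨le_rfl, hi⟩] at h1
  simp [unitSl, toSl, hba] at h1

/-- The polynomial part of the `r`-matrix defined by a transversal graph. -/
def rPoly (h : IsCompl (adGraph g) (parabolicTriple N i)) : TensorPoly N :=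
  Finsupp.single (0, 0) (LinearMap.rTensor (Sl N)
      (constTerm h ∘ₗ LinearMap.inr ℂ (Sl N) (Sl N)) (omega N) - omegaPlus N) +
    Finsupp.single (1, 0) (LinearMap.rTensor (Sl N)
      (linTerm h ∘ₗ LinearMap.inr ℂ (Sl N) (Sl N)) (omega N)) +
    Finsupp.single (0, 1) (LinearMap.rTensor (Sl N)
      (constTerm h ∘ₗ (-(LinearMap.inl ℂ (Sl N) (Sl N) ∘ₗ lowerPart N i))) (omega N)) +
    Finsupp.single (1, 1) (LinearMap.rTensor (Sl N)
      (linTerm h ∘ₗ (-(LinearMap.inl ℂ (Sl N) (Sl N) ∘ₗ lowerPart N i))) (omega N))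

theorem isDefinedBy_rPoly (h : IsCompl (adGraph g) (parabolicTriple N i)) :
    IsDefinedBy i (rPoly h) (adGraph g) := by
  rw [isDefinedBy_iff]
  intro k ξ
  generalize hx : contract ξ (omega N) = x
  have hm : ∀ m, 1 < m → contract ξ (rPoly h (m, k)) = 0 := by
    intro m hm
    have : rPoly h (m, k) = 0 := by
      rw [rPoly]
      simp [show ¬(0 = m) by omega, show ¬(1 = m) by omega]
    rw [this, ← contractHom_apply, map_zero]
  refine ⟨hm, ?_⟩
  match k with
  | 0 =>
    have h1 : contract ξ (rPoly h (1, 0)) = linTerm h (0, x) := by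
      rw [← hx]
      simp [rPoly, contract_rTensor]
    have h0 : constCoeff (rPoly h) 0 ξ = constTerm h (0, x) := by
      rw [← hx, constCoeff, if_pos rfl]
      simp only [← contractHom_apply, ← map_add]
      simp [rPoly, contractHom_apply, contract_rTensor]
    rw [h1, h0, if_pos rfl, if_neg zero_ne_one]
    refine ⟨upperPart_linTerm h _, lowerPart_constTerm h _, ?_⟩
    have := constTerm_sub_mem_adGraph h (0, x)
    rwa [sub_zero, ← add_zero (leviPart N i (constTerm h (0, x)))] at this
  | 1 =>
    have h1 : contract ξ (rPoly h (1, 1)) = linTerm h (-lowerPart N i x, 0) := by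
      have e : rPoly h (1, 1) = LinearMap.rTensor (Sl N) (linTerm h ∘ₗ
          (-(LinearMap.inl ℂ (Sl N) (Sl N) ∘ₗ lowerPart N i))) (omega N) := by
        simp [rPoly]
      rw [e, contract_rTensor, hx]
      refine congrArg (linTerm h) ?_
      simp
    have h0 : constCoeff (rPoly h) 1 ξ = constTerm h (-lowerPart N i x, 0) := by
      have e : rPoly h (0, 1) = LinearMap.rTensor (Sl N) (constTerm h ∘ₗ
          (-(LinearMap.inl ℂ (Sl N) (Sl N) ∘ₗ lowerPart N i))) (omega N) := by
        simp [rPoly]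
      rw [constCoeff, if_neg one_ne_zero, add_zero, e, contract_rTensor, hx]
      refine congrArg (constTerm h) ?_
      simp
    rw [h1, h0, if_pos rfl, if_neg one_ne_zero]
    refine ⟨upperPart_linTerm h _, lowerPart_constTerm h _, ?_⟩
    have := constTerm_sub_mem_adGraph h (-lowerPart N i x, 0)
    rwa [sub_neg_eq_add] at this
  | k + 2 =>
    have h1 : contract ξ (rPoly h (1, k + 2)) = 0 := by
      simp [rPoly, ← contractHom_apply]
    have h0 : constCoeff (rPoly h) (k + 2) ξ = 0 := by
      rw [constCoeff, if_neg (by omega)]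
      simp [rPoly, ← contractHom_apply]
    rw [h1, h0, if_neg (by omega), if_neg (by omega)]
    refine ⟨map_zero _, map_zero _, ?_⟩
    rw [map_zero, add_zero, add_zero, sub_zero]
    exact Submodule.zero_mem (adGraph g)

/-- The operator `T` for which `X(u, v) = v Ω / (u - v) + (T ⊗ 1) Ω`. -/
def regOp (h : IsCompl (adGraph g) (parabolicTriple N i)) (u v : ℂ) : Sl N →ₗ[ℂ] Sl N :=
  constTerm h ∘ₗ seed N i v + u • (linTerm h ∘ₗ seed N i v)

theorem rMat_rPoly (h : IsCompl (adGraph g) (parabolicTriple N i)) {u v : ℂ} (huv : u ≠ v) :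
    rMat (rPoly h) u v = (v / (u - v)) • omega N +
      LinearMap.rTensor (Sl N) (regOp h u v) (omega N) := by
  have huv' : u - v ≠ 0 := sub_ne_zero.2 huv
  have hpole : (u - v)⁻¹ • (u • omegaPlus N + v • omegaMinus N) =
      (v / (u - v)) • omega N + omegaPlus N := by
    rw [omega, smul_add, smul_add, smul_smul, smul_smul,
      show (u - v)⁻¹ * u = v / (u - v) + 1 by field_simp; ring, add_smul, one_smul,
      show (u - v)⁻¹ * v = v / (u - v) by field_simp]
    abel
  have hsum : ((rPoly h).sum fun m c => (u ^ m.1 * v ^ m.2) • c) =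
      LinearMap.rTensor (Sl N) (regOp h u v) (omega N) - omegaPlus N := by
    have hs : regOp h u v = constTerm h ∘ₗ LinearMap.inr ℂ (Sl N) (Sl N) +
        u • (linTerm h ∘ₗ LinearMap.inr ℂ (Sl N) (Sl N)) +
        v • (constTerm h ∘ₗ (-(LinearMap.inl ℂ (Sl N) (Sl N) ∘ₗ lowerPart N i))) +
        (u * v) • (linTerm h ∘ₗ (-(LinearMap.inl ℂ (Sl N) (Sl N) ∘ₗ lowerPart N i))) := by
      ext1 x
      simp only [regOp, seed, LinearMap.comp_apply, LinearMap.add_apply, LinearMap.sub_apply,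
        LinearMap.smul_apply, LinearMap.neg_apply, map_sub, map_smul, map_neg, smul_sub, mul_smul,
        smul_neg]
      abel
    rw [hs, rPoly]
    rw [Finsupp.sum_add_index', Finsupp.sum_add_index', Finsupp.sum_add_index',
      Finsupp.sum_single_index, Finsupp.sum_single_index, Finsupp.sum_single_index,
      Finsupp.sum_single_index]
    · simp only [LinearMap.rTensor_add, LinearMap.rTensor_smul, LinearMap.add_apply,
        LinearMap.smul_apply, pow_zero, pow_one, mul_one, one_mul, one_smul]
      abel
    all_goals first
      | exact fun _ => smul_zero _
      | exact fun _ _ _ => smul_add _ _ _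
      | exact smul_zero _
  rw [rMat, hpole, hsum]
  abel

theorem isUnitary_rMat_rPoly (h : IsCompl (adGraph g) (parabolicTriple N i)) :
    IsUnitary (rMat (rPoly h)) := by
  intro u v huv
  have hadj : TensorProduct.comm ℂ (Sl N) (Sl N)
      (LinearMap.rTensor (Sl N) (regOp h v u) (omega N)) =
      LinearMap.rTensor (Sl N) (LinearMap.id - regOp h u v) (omega N) := by
    refine comm_rTensor_omega fun x y => ?_
    have := trForm_constTerm_add_linTerm h u v x y
    simp only [LinearMap.sub_apply, LinearMap.id_apply, map_sub]
    rw [sub_eq_iff_eq_add', ← this]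
    rfl
  have huv' : u - v ≠ 0 := sub_ne_zero.2 huv
  have hvu' : v - u ≠ 0 := sub_ne_zero.2 huv.symm
  rw [rMat_rPoly h huv, rMat_rPoly h huv.symm, map_add, map_smul, comm_omega, hadj,
    LinearMap.rTensor_sub, LinearMap.sub_apply, LinearMap.rTensor_id, LinearMap.id_apply,
    show u / (v - u) = -(v / (u - v)) - 1 by
      rw [← neg_sub u v, div_neg]; field_simp; ring, sub_smul, neg_smul, one_smul]
  abel

/-! ### Noncommutative identities behind the Yang-Baxter equation -/

section Commutators

variable {A : Type*} [Ring A]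

theorem comm_add_left (a b c : A) : comm (a + b) c = comm a c + comm b c := by
  simp only [comm]; noncomm_ring

theorem comm_add_right (a b c : A) : comm a (b + c) = comm a b + comm a c := by
  simp only [comm]; noncomm_ring

theorem comm_sub_left (a b c : A) : comm (a - b) c = comm a c - comm b c := by
  simp only [comm]; noncomm_ring

theorem comm_sub_right (a b c : A) : comm a (b - c) = comm a b - comm a c := by
  simp only [comm]; noncomm_ring

theorem comm_smul_left [Algebra ℂ A] (r : ℂ) (a b : A) : comm (r • a) b = r • comm a b := by
  simp only [comm, smul_mul_assoc, mul_smul_comm, smul_sub]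

theorem comm_smul_right [Algebra ℂ A] (r : ℂ) (a b : A) : comm a (r • b) = r • comm a b := by
  simp only [comm, smul_mul_assoc, mul_smul_comm, smul_sub]

theorem comm_swap (a b : A) : comm a b = -comm b a := by
  simp only [comm, neg_sub]

/-- The Yang-Baxter expression has no poles in the first variable `u`: the residues at `u = v` and
`u = w` are the left hand sides of the two hypotheses. What remains is a polynomial in `u`. -/
theorem yangBaxter_eq_polynomial [Algebra ℂ A] {O₂ O₃ a₀ a₁ b₀ b₁ s : A} {u v w : ℂ}
    (huv : u ≠ v) (huw : u ≠ w) (hvw : v ≠ w)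
    (h₂ : comm O₂ ((w / (v - w)) • O₃ + (b₀ + v • b₁) + s) = 0)
    (h₃ : comm O₃ ((v / (w - v)) • O₂ + (a₀ + w • a₁) - s) = 0) :
    comm ((v / (u - v)) • O₂ + (a₀ + u • a₁)) ((w / (u - w)) • O₃ + (b₀ + u • b₁)) +
        comm ((v / (u - v)) • O₂ + (a₀ + u • a₁)) s +
        comm ((w / (u - w)) • O₃ + (b₀ + u • b₁)) s =
      (comm (a₀ - O₂) (b₀ - O₃) + comm (a₀ - O₂) s + comm (b₀ - O₃) s) +
        u • (comm a₀ b₁ + comm a₁ b₀ + comm a₁ s + comm b₁ s) + u ^ 2 • comm a₁ b₁ := by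
  have huv' : u - v ≠ 0 := sub_ne_zero.2 huv
  have huw' : u - w ≠ 0 := sub_ne_zero.2 huw
  have hvw' : v - w ≠ 0 := sub_ne_zero.2 hvw
  have hwv' : w - v ≠ 0 := sub_ne_zero.2 hvw.symm
  simp only [comm_add_left, comm_add_right, comm_sub_left, comm_sub_right, comm_smul_left,
    comm_smul_right, comm_swap O₃ O₂, comm_swap O₃ a₀, comm_swap O₃ a₁] at h₂ h₃ ⊢
  linear_combination (norm := skip) (u / (u - v)) • h₂ - (u / (u - w)) • h₃
  match_scalars <;> field_simp <;> ring

/-- The Peirce component `X x Y` of `x`. -/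
def peirce (X Y x : A) : A := X * x * Y

theorem peirce_add (X Y x y : A) : peirce X Y (x + y) = peirce X Y x + peirce X Y y := by
  simp only [peirce, mul_add, add_mul]

theorem peirce_sub (X Y x y : A) : peirce X Y (x - y) = peirce X Y x - peirce X Y y := by
  simp only [peirce, mul_sub, sub_mul]

theorem peirce_smul [Algebra ℂ A] (X Y x : A) (r : ℂ) : peirce X Y (r • x) = r • peirce X Y x := by
  simp only [peirce, mul_smul_comm, smul_mul_assoc]

variable {P Q : A}

/-- `P` and `Q` are complementary orthogonal idempotents. -/
structure IsPeircePair (P Q : A) : Prop where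
  add_eq_one : P + Q = 1
  mul_self_fst : P * P = P
  mul_self_snd : Q * Q = Q
  mul_fst_snd : P * Q = 0
  mul_snd_fst : Q * P = 0

theorem IsPeircePair.peirce_mul (h : IsPeircePair P Q) (X Y x y : A) :
    peirce X Y (x * y) = peirce X P x * peirce P Y y + peirce X Q x * peirce Q Y y := by
  have : peirce X P x * peirce P Y y + peirce X Q x * peirce Q Y y =
      X * x * (P * P + Q * Q) * y * Y := by
    simp only [peirce]; noncomm_ring
  rw [this, h.mul_self_fst, h.mul_self_snd, h.add_eq_one, peirce]
  noncomm_ring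

theorem IsPeircePair.ext (h : IsPeircePair P Q) {x y : A} (h₁ : peirce P P x = peirce P P y)
    (h₂ : peirce P Q x = peirce P Q y) (h₃ : peirce Q P x = peirce Q P y)
    (h₄ : peirce Q Q x = peirce Q Q y) : x = y := by
  have key : ∀ z, z = peirce P P z + peirce P Q z + peirce Q P z + peirce Q Q z := by
    intro z
    have : peirce P P z + peirce P Q z + peirce Q P z + peirce Q Q z =
        (P + Q) * z * (P + Q) := by simp only [peirce]; noncomm_ring
    rw [this, h.add_eq_one, one_mul, mul_one]
  rw [key x, h₁, h₂, h₃, h₄, ← key y]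

/-- The data of one leg of `X` at a value `v` of the second variable: the polar part `O`, the regular
part `a₀ + u a₁` and the limit `F` at `u = ∞` of the conjugate by `D`, which is read off from the
coefficients of `X`. -/
structure IsLegData [Algebra ℂ A] (P Q : A) (v : ℂ) (O a₀ a₁ F : A) : Prop where
  const_lower : peirce Q P a₀ = 0
  lin_fst : peirce P P a₁ = 0
  lin_snd : peirce Q Q a₁ = 0
  lin_lower : peirce Q P a₁ = 0
  lim_fst : peirce P P F = peirce P P a₀
  lim_snd : peirce Q Q F = peirce Q Q a₀
  lim_lower : peirce Q P F = v • peirce Q P O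
  lim_upper : peirce P Q F = peirce P Q a₁

/-- The conjugate by `D` of the polynomial `c₀ + u c₁ + u² c₂` of `yangBaxter_eq_polynomial` has the
limit `[F₂, F₃] + [F₂, s] + [F₃, s]` at `u = ∞`. In terms of blocks, this limit and `c₀` form an
element of `(P_i, P_i, id)`; moreover `c₂ = 0`, and `c₁ = 0` if the limit vanishes. -/
theorem peirce_yangBaxter [Algebra ℂ A] (hPQ : IsPeircePair P Q)
    {O₂ O₃ a₀ a₁ b₀ b₁ s F₂ F₃ : A} {v w : ℂ} (hvw : v ≠ w)
    (h₂ : comm O₂ ((w / (v - w)) • O₃ + (b₀ + v • b₁) + s) = 0)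
    (h₃ : comm O₃ ((v / (w - v)) • O₂ + (a₀ + w • a₁) - s) = 0)
    (hs : peirce P Q s = 0) (hs' : peirce Q P s = 0)
    (ha : IsLegData P Q v O₂ a₀ a₁ F₂) (hb : IsLegData P Q w O₃ b₀ b₁ F₃)
    {C L : A} (hC : C = comm (a₀ - O₂) (b₀ - O₃) + comm (a₀ - O₂) s + comm (b₀ - O₃) s)
    (hL : L = comm F₂ F₃ + comm F₂ s + comm F₃ s) :
    peirce Q P C = 0 ∧ peirce Q P L = 0 ∧ peirce P P L = peirce P P C ∧
      peirce Q Q L = peirce Q Q C ∧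
      (L = 0 → comm a₀ b₁ + comm a₁ b₀ + comm a₁ s + comm b₁ s = 0) ∧ comm a₁ b₁ = 0 := by
  have hvw' : v - w ≠ 0 := sub_ne_zero.2 hvw
  have hwv' : w - v ≠ 0 := sub_ne_zero.2 hvw.symm
  -- Both residue equations contain `[O₂, O₃]`; it is eliminated in two ways.
  have hC' : C = v • comm O₂ b₁ + w • comm a₁ O₃ + comm a₀ b₀ + comm a₀ s + comm b₀ s := by
    rw [hC]
    simp only [comm_add_right, comm_sub_left, comm_sub_right,
      comm_smul_right, comm_swap O₃ O₂, comm_swap O₃ a₀, comm_swap O₃ a₁] at h₂ h₃ ⊢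
    linear_combination (norm := skip) h₃ - h₂
    match_scalars <;> field_simp <;> ring
  have hres : v • (comm O₂ b₀ + v • comm O₂ b₁ + comm O₂ s) +
      w • (comm a₀ O₃ + w • comm a₁ O₃ + comm O₃ s) = 0 := by
    simp only [comm_add_right, comm_sub_right,
      comm_smul_right, comm_swap O₃ O₂, comm_swap O₃ a₀, comm_swap O₃ a₁] at h₂ h₃ ⊢
    linear_combination (norm := skip) v • h₂ - w • h₃
    match_scalars <;> field_simp <;> ring
  have hresQP := congrArg (peirce Q P) hres
  have hzero : ∀ X Y : A, peirce X Y 0 = 0 := fun X Y => by simp [peirce]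
  obtain ⟨ha1, ha2, ha3, ha4, ha5, ha6, ha7, ha8⟩ := ha
  obtain ⟨hb1, hb2, hb3, hb4, hb5, hb6, hb7, hb8⟩ := hb
  refine ⟨?_, ?_, ?_, ?_, fun hL0 => ?_, ?_⟩
  · rw [hC']
    simp only [comm, peirce_add, peirce_sub, peirce_smul, hPQ.peirce_mul, ha1, ha2, ha3, ha4, hb1,
      hb2, hb3, hb4, hs', mul_zero, zero_mul, add_zero, sub_zero, smul_zero]
  · rw [hL]
    simp only [comm, peirce_add, peirce_sub, peirce_smul, hPQ.peirce_mul, ha1, ha2, ha3, ha4, ha5,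
      ha6, ha7, hb1, hb2, hb3, hb4, hb5, hb6, hb7, hs', mul_zero, zero_mul, add_zero,
      zero_add, sub_zero, smul_zero, smul_mul_assoc, mul_smul_comm, hzero] at hresQP ⊢
    linear_combination (norm := module) hresQP
  · rw [hL, hC']
    simp only [comm, peirce_add, peirce_sub, peirce_smul, hPQ.peirce_mul, ha1, ha2, ha4, ha5,
      ha7, ha8, hb1, hb2, hb4, hb5, hb7, hb8, hs, hs', mul_zero, zero_mul, add_zero,
      zero_add, sub_zero, zero_sub, smul_zero, mul_smul_comm]
    module
  · rw [hL, hC']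
    simp only [comm, peirce_add, peirce_sub, peirce_smul, hPQ.peirce_mul, ha1, ha3, ha4,
      ha6, ha7, ha8, hb1, hb3, hb4, hb6, hb7, hb8, hs, hs', mul_zero, zero_mul, add_zero,
      zero_add, sub_zero, zero_sub, smul_mul_assoc]
    module
  · have hLPQ := congrArg (peirce P Q) (hL.symm.trans hL0)
    refine hPQ.ext ?_ ?_ ?_ ?_
    all_goals
      simp only [comm, peirce_add, peirce_sub, hPQ.peirce_mul, ha1, ha2, ha3, ha4, ha5,
        ha6, ha8, hb1, hb2, hb3, hb4, hb5, hb6, hb8, hs, hs', mul_zero, zero_mul, add_zero,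
        zero_add, sub_zero, hzero] at hLPQ ⊢
    linear_combination (norm := module) hLPQ
  · refine hPQ.ext ?_ ?_ ?_ ?_ <;>
      simp only [comm, peirce_sub, hPQ.peirce_mul, ha2, ha3, ha4, hb2, hb3, hb4, mul_zero,
        zero_mul, add_zero, sub_zero, hzero]

end Commutators

/-! ### Invariance of the Casimir tensor -/

/-- The flip of `ℂ^N ⊗ ℂ^N`, as an element of `Mat_N ⊗ Mat_N`. -/
def flip (N : ℕ) : Mat N ⊗[ℂ] Mat N :=
  ∑ a : Fin N, ∑ b : Fin N, Matrix.single a b (1 : ℂ) ⊗ₜ[ℂ] Matrix.single b a (1 : ℂ)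

theorem single_mul_eq_sum (x : Mat N) (a b : Fin N) :
    Matrix.single a b (1 : ℂ) * x = ∑ c : Fin N, x b c • Matrix.single a c (1 : ℂ) := by
  ext p q
  simp only [Matrix.sum_apply, Matrix.smul_apply, Matrix.single_apply, smul_eq_mul,
    Matrix.mul_apply, ite_and]
  by_cases h : a = p <;> simp [h]

theorem mul_single_eq_sum (x : Mat N) (a b : Fin N) :
    x * Matrix.single a b (1 : ℂ) = ∑ c : Fin N, x c a • Matrix.single c b (1 : ℂ) := by
  ext p q
  simp only [Matrix.sum_apply, Matrix.smul_apply, Matrix.single_apply, smul_eq_mul,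
    Matrix.mul_apply, ite_and]
  by_cases h : b = q <;> simp [h]

theorem flip_mul_tmul_one (x : Mat N) :
    flip N * (x ⊗ₜ[ℂ] (1 : Mat N)) = ((1 : Mat N) ⊗ₜ[ℂ] x) * flip N := by
  simp only [flip, Finset.sum_mul, Finset.mul_sum, Algebra.TensorProduct.tmul_mul_tmul, mul_one,
    one_mul, single_mul_eq_sum, mul_single_eq_sum, TensorProduct.sum_tmul, TensorProduct.tmul_sum,
    TensorProduct.smul_tmul', TensorProduct.tmul_smul]
  refine Finset.sum_congr rfl fun a _ => ?_
  exact Finset.sum_comm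

theorem flip_mul_one_tmul (x : Mat N) :
    flip N * ((1 : Mat N) ⊗ₜ[ℂ] x) = (x ⊗ₜ[ℂ] (1 : Mat N)) * flip N := by
  simp only [flip, Finset.sum_mul, Finset.mul_sum, Algebra.TensorProduct.tmul_mul_tmul, mul_one,
    one_mul, single_mul_eq_sum, mul_single_eq_sum, TensorProduct.sum_tmul, TensorProduct.tmul_sum,
    TensorProduct.smul_tmul', TensorProduct.tmul_smul]
  rw [Finset.sum_comm]
  conv_rhs => rw [Finset.sum_comm]
  refine Finset.sum_congr rfl fun a _ => ?_
  exact Finset.sum_comm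

theorem slIncl_omega (hN : N ≠ 0) :
    slIncl N (omega N) = flip N - (1 / N : ℂ) • (1 : Mat N ⊗[ℂ] Mat N) := by
  have hN' : (N : ℂ) ≠ 0 := by exact_mod_cast hN
  have hcoe : ∀ a b : Fin N, (unitSl a b).1 =
      Matrix.single a b (1 : ℂ) - (if a = b then (1 / N : ℂ) else 0) • (1 : Mat N) := by
    intro a b
    change Matrix.single a b (1 : ℂ) - ((Matrix.single a b (1 : ℂ)).trace / N) • (1 : Mat N) = _
    by_cases h : a = b
    · rw [h, Matrix.trace_single_eq_same, if_pos rfl]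
    · rw [Matrix.trace_single_eq_of_ne _ _ _ h, if_neg h, zero_div]
  have hone : ∑ a : Fin N, Matrix.single a a (1 : ℂ) = 1 := by
    ext p q
    simp [Matrix.sum_apply, Matrix.single_apply, Matrix.one_apply, ite_and]
  have hterm : ∀ a b : Fin N, slIncl N (unitSl a b ⊗ₜ[ℂ] unitSl b a) =
      Matrix.single a b (1 : ℂ) ⊗ₜ[ℂ] Matrix.single b a (1 : ℂ) -
      (if a = b then ((1 / N : ℂ) • (Matrix.single a a (1 : ℂ) ⊗ₜ[ℂ] (1 : Mat N)) +
        (1 / N : ℂ) • ((1 : Mat N) ⊗ₜ[ℂ] Matrix.single a a (1 : ℂ)) -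
        ((1 / N : ℂ) * (1 / N : ℂ)) • (1 : Mat N ⊗[ℂ] Mat N)) else 0) := by
    intro a b
    change (unitSl a b).1 ⊗ₜ[ℂ] (unitSl b a).1 = _
    rw [hcoe, hcoe]
    by_cases h : a = b
    · subst h
      simp only [if_true, TensorProduct.sub_tmul, TensorProduct.tmul_sub, ← TensorProduct.smul_tmul',
        TensorProduct.tmul_smul, Algebra.TensorProduct.one_def]
      module
    · simp only [if_neg h, if_neg (Ne.symm h), zero_smul, sub_zero]
  rw [omega_eq_sum]
  simp only [map_sum, hterm, Finset.sum_sub_distrib, Finset.sum_ite_eq, Finset.mem_univ, if_true,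
    Finset.sum_add_distrib, ← Finset.smul_sum, ← TensorProduct.sum_tmul, ← TensorProduct.tmul_sum,
    hone, Finset.sum_const, Finset.card_univ, Fintype.card_fin]
  rw [← Algebra.TensorProduct.one_def, flip]
  match_scalars
  · ring
  · field_simp; ring

/-- Invariance of `Ω`: placed in two legs of an algebra by `φ`, it commutes with the sum of the two
ways `l₁`, `l₂` of placing the first factor of a tensor into these legs, the second factor going to
a leg `ε` that commutes with them. -/
theorem comm_omega_map {A : Type*} [Ring A] [Algebra ℂ A] (φ : Mat N ⊗[ℂ] Mat N →ₐ[ℂ] A)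
    (ε : Mat N → A) (hε : ∀ t y, φ t * ε y = ε y * φ t) (l₁ l₂ : Sl N ⊗[ℂ] Sl N →ₗ[ℂ] A)
    (h₁ : ∀ x y, l₁ (x ⊗ₜ[ℂ] y) = φ (x.1 ⊗ₜ[ℂ] 1) * ε y.1)
    (h₂ : ∀ x y, l₂ (x ⊗ₜ[ℂ] y) = φ (1 ⊗ₜ[ℂ] x.1) * ε y.1) (t : Sl N ⊗[ℂ] Sl N) :
    comm (φ (slIncl N (omega N))) (l₁ t + l₂ t) = 0 := by
  induction t with
  | zero => simp [comm]
  | add s t hs ht =>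
    rw [map_add, map_add, add_add_add_comm, comm_add_right, hs, ht, add_zero]
  | tmul x y =>
    rw [h₁, h₂]
    rcases eq_or_ne N 0 with rfl | hN
    · have : Subsingleton (Mat 0) := inferInstance
      rw [Subsingleton.elim x.1 0]
      simp [comm]
    have hflip : comm (φ (flip N)) (φ (x.1 ⊗ₜ[ℂ] 1) * ε y.1 + φ (1 ⊗ₜ[ℂ] x.1) * ε y.1) = 0 := by
      rw [comm, mul_add, add_mul, ← mul_assoc, ← mul_assoc, mul_assoc _ (ε y.1),
        mul_assoc _ (ε y.1), ← hε, ← mul_assoc, ← mul_assoc, ← map_mul, ← map_mul, ← map_mul,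
        ← map_mul, flip_mul_tmul_one, flip_mul_one_tmul]
      abel
    rw [slIncl_omega hN, map_sub, map_smul, map_one, comm_sub_left, hflip, comm_smul_left]
    simp [comm]

/-! ### The first leg of a tensor product of algebras -/

section FirstLeg

variable {B : Type*} [Ring B] [Algebra ℂ B]

/-- `a ⊗ b ↦ a ⊗ j(b)` for a linear map `j` from `𝔰𝔩_N` to an algebra. -/
def legMap (j : Sl N →ₗ[ℂ] B) : Sl N ⊗[ℂ] Sl N →ₗ[ℂ] Mat N ⊗[ℂ] B :=
  TensorProduct.map (LieAlgebra.SpecialLinear.sl (Fin N) ℂ).toSubmodule.subtype j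

theorem legMap_tmul (j : Sl N →ₗ[ℂ] B) (x y : Sl N) :
    legMap j (x ⊗ₜ[ℂ] y) = x.1 ⊗ₜ[ℂ] j y := rfl

/-- A matrix placed in the first leg. -/
def firstLeg (N : ℕ) (B : Type*) [Ring B] [Algebra ℂ B] : Mat N →ₐ[ℂ] Mat N ⊗[ℂ] B :=
  Algebra.TensorProduct.includeLeft

theorem firstLeg_apply (x : Mat N) : firstLeg N B x = x ⊗ₜ[ℂ] 1 := rfl

theorem peirce_firstLeg_tmul (x y z : Mat N) (b : B) :
    peirce (firstLeg N B x) (firstLeg N B y) (z ⊗ₜ[ℂ] b) = (x * z * y) ⊗ₜ[ℂ] b := by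
  rw [peirce, firstLeg_apply, firstLeg_apply, Algebra.TensorProduct.tmul_mul_tmul,
    Algebra.TensorProduct.tmul_mul_tmul, one_mul, mul_one]

theorem peirce_legMap_eq {j : Sl N →ₗ[ℂ] B} {x y x' y' : Mat N}
    {S T : Sl N →ₗ[ℂ] Sl N} (h : ∀ z, x * (S z).1 * y = x' * (T z).1 * y')
    (t : Sl N ⊗[ℂ] Sl N) :
    peirce (firstLeg N B x) (firstLeg N B y) (legMap j (LinearMap.rTensor (Sl N) S t)) =
      peirce (firstLeg N B x') (firstLeg N B y') (legMap j (LinearMap.rTensor (Sl N) T t)) := by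
  induction t with
  | zero => simp [peirce]
  | tmul a b =>
    rw [LinearMap.rTensor_tmul, LinearMap.rTensor_tmul, legMap_tmul, legMap_tmul,
      peirce_firstLeg_tmul, peirce_firstLeg_tmul, h]
  | add s t hs ht => simp only [map_add, peirce_add, hs, ht]

theorem isPeircePair_firstLeg (N i : ℕ) (B : Type*) [Ring B] [Algebra ℂ B] :
    IsPeircePair (firstLeg N B (projFst N i)) (firstLeg N B (projSnd N i)) where
  add_eq_one := by rw [← map_add, projFst_add_projSnd, map_one]
  mul_self_fst := by rw [← map_mul, projFst_mul_self]
  mul_self_snd := by rw [← map_mul, projSnd_mul_self]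
  mul_fst_snd := by rw [← map_mul, projFst_mul_projSnd, map_zero]
  mul_snd_fst := by rw [← map_mul, projSnd_mul_projFst, map_zero]

theorem isLegData_legMap (h : IsCompl (adGraph g) (parabolicTriple N i))
    (j : Sl N →ₗ[ℂ] B) (v : ℂ) (t : Sl N ⊗[ℂ] Sl N) :
    IsLegData (firstLeg N B (projFst N i)) (firstLeg N B (projSnd N i)) v (legMap j t)
      (legMap j (LinearMap.rTensor (Sl N) (constTerm h ∘ₗ seed N i v) t))
      (legMap j (LinearMap.rTensor (Sl N) (linTerm h ∘ₗ seed N i v) t))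
      (legMap j (LinearMap.rTensor (Sl N)
        (leviPart N i ∘ₗ constTerm h ∘ₗ seed N i v + v • lowerPart N i +
          linTerm h ∘ₗ seed N i v) t)) := by
  have hzero : ∀ x y : Mat N, peirce (firstLeg N B x) (firstLeg N B y)
      (legMap j (LinearMap.rTensor (Sl N) 0 t)) = 0 := by
    intro x y
    rw [LinearMap.rTensor_zero, LinearMap.zero_apply, map_zero, peirce, mul_zero, zero_mul]
  have hc : ∀ z, projSnd N i * (constTerm h (seed N i v z)).1 * projFst N i = 0 := fun z =>
    congrArg Subtype.val (lowerPart_constTerm h (seed N i v z))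
  have hl : ∀ z, (linTerm h (seed N i v z)).1 =
      projFst N i * (linTerm h (seed N i v z)).1 * projSnd N i := fun z =>
    congrArg Subtype.val (upperPart_linTerm h (seed N i v z)).symm
  have PP := projFst_mul_self N i
  have QQ := projSnd_mul_self N i
  have PQ := projFst_mul_projSnd N i
  have QP := projSnd_mul_projFst N i
  have hF : ∀ z, ((leviPart N i ∘ₗ constTerm h ∘ₗ seed N i v + v • lowerPart N i +
      linTerm h ∘ₗ seed N i v) z).1 =
      (projFst N i * (constTerm h (seed N i v z)).1 * projFst N i +
        projSnd N i * (constTerm h (seed N i v z)).1 * projSnd N i) +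
      v • (projSnd N i * z.1 * projFst N i) +
      projFst N i * (linTerm h (seed N i v z)).1 * projSnd N i := by
    intro z
    rw [← hl, ← leviPart_coe]; rfl
  constructor
  · rw [← hzero 0 0]
    refine peirce_legMap_eq (fun z => ?_) t
    rw [LinearMap.comp_apply, hc]
    simp
  · rw [← hzero 0 0]
    refine peirce_legMap_eq (fun z => ?_) t
    rw [LinearMap.comp_apply, hl]
    simp [mul_assoc, QP]
  · rw [← hzero 0 0]
    refine peirce_legMap_eq (fun z => ?_) t
    rw [LinearMap.comp_apply, hl]
    simp [← mul_assoc, QP]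
  · rw [← hzero 0 0]
    refine peirce_legMap_eq (fun z => ?_) t
    rw [LinearMap.comp_apply, hl]
    simp [← mul_assoc, QP]
  · refine peirce_legMap_eq (fun z => ?_) t
    rw [hF, LinearMap.comp_apply]
    generalize (constTerm h (seed N i v z)).1 = c
    generalize (linTerm h (seed N i v z)).1 = l
    calc _ = (projFst N i * projFst N i) * c * (projFst N i * projFst N i) +
          (projFst N i * projSnd N i) * c * (projSnd N i * projFst N i) +
          v • ((projFst N i * projSnd N i) * z.1 * (projFst N i * projFst N i)) +
          (projFst N i * projFst N i) * l * (projSnd N i * projFst N i) := by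
            simp only [mul_add, add_mul, mul_assoc, mul_smul_comm, smul_mul_assoc]
      _ = _ := by rw [PP, PQ, QP]; simp
  · refine peirce_legMap_eq (fun z => ?_) t
    rw [hF, LinearMap.comp_apply]
    generalize (constTerm h (seed N i v z)).1 = c
    generalize (linTerm h (seed N i v z)).1 = l
    calc _ = (projSnd N i * projFst N i) * c * (projFst N i * projSnd N i) +
          (projSnd N i * projSnd N i) * c * (projSnd N i * projSnd N i) +
          v • ((projSnd N i * projSnd N i) * z.1 * (projFst N i * projSnd N i)) +
          (projSnd N i * projFst N i) * l * (projSnd N i * projSnd N i) := by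
            simp only [mul_add, add_mul, mul_assoc, mul_smul_comm, smul_mul_assoc]
      _ = _ := by rw [QQ, PQ, QP]; simp
  · have e : v • peirce (firstLeg N B (projSnd N i)) (firstLeg N B (projFst N i)) (legMap j t) =
        peirce (firstLeg N B (projSnd N i)) (firstLeg N B (projFst N i))
          (legMap j (LinearMap.rTensor (Sl N) (v • LinearMap.id) t)) := by
      rw [LinearMap.rTensor_smul, LinearMap.smul_apply, LinearMap.rTensor_id, LinearMap.id_apply,
        map_smul, peirce_smul]
    rw [e]
    refine peirce_legMap_eq (fun z => ?_) t
    rw [hF]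
    change _ = projSnd N i * (v • z.1) * projFst N i
    generalize (constTerm h (seed N i v z)).1 = c
    generalize (linTerm h (seed N i v z)).1 = l
    calc _ = (projSnd N i * projFst N i) * c * (projFst N i * projFst N i) +
          (projSnd N i * projSnd N i) * c * (projSnd N i * projFst N i) +
          v • ((projSnd N i * projSnd N i) * z.1 * (projFst N i * projFst N i)) +
          (projSnd N i * projFst N i) * l * (projSnd N i * projFst N i) := by
            simp only [mul_add, add_mul, mul_assoc, mul_smul_comm, smul_mul_assoc]
      _ = _ := by rw [PP, QQ, QP]; simp
  · refine peirce_legMap_eq (fun z => ?_) t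
    rw [hF, LinearMap.comp_apply]
    generalize (constTerm h (seed N i v z)).1 = c
    generalize (linTerm h (seed N i v z)).1 = l
    calc _ = (projFst N i * projFst N i) * c * (projFst N i * projSnd N i) +
          (projFst N i * projSnd N i) * c * (projSnd N i * projSnd N i) +
          v • ((projFst N i * projSnd N i) * z.1 * (projFst N i * projSnd N i)) +
          (projFst N i * projFst N i) * l * (projSnd N i * projSnd N i) := by
            simp only [mul_add, add_mul, mul_assoc, mul_smul_comm, smul_mul_assoc]
      _ = _ := by rw [PP, QQ, PQ]; simp

end FirstLeg

/-! ### Absence of poles implies vanishing -/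

section Contraction

variable {B : Type*} [Ring B] [Algebra ℂ B]

/-- The contraction of all legs but the first with a linear form. -/
def contractTail (N : ℕ) (β : Module.Dual ℂ B) : Mat N ⊗[ℂ] B →ₗ[ℂ] Mat N :=
  (TensorProduct.rid ℂ (Mat N)).toLinearMap ∘ₗ LinearMap.lTensor (Mat N) β

theorem contractTail_tmul (β : Module.Dual ℂ B) (x : Mat N) (b : B) :
    contractTail N β (x ⊗ₜ[ℂ] b) = β b • x := by
  simp [contractTail]

theorem contractTail_peirce (β : Module.Dual ℂ B) (x y : Mat N) (t : Mat N ⊗[ℂ] B) :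
    contractTail N β (peirce (firstLeg N B x) (firstLeg N B y) t) =
      x * contractTail N β t * y := by
  induction t with
  | zero => simp [peirce]
  | tmul z b =>
    rw [peirce_firstLeg_tmul, contractTail_tmul, contractTail_tmul, mul_smul_comm, smul_mul_assoc]
  | add s t hs ht => simp only [map_add, peirce_add, hs, ht, mul_add, add_mul]

theorem trace_contractTail_comm_legMap (β : Module.Dual ℂ B) {j j' : Sl N →ₗ[ℂ] B}
    (hj : ∀ x y, j x * j' y = j' y * j x) (s t : Sl N ⊗[ℂ] Sl N) :
    (contractTail N β (comm (legMap j s) (legMap j' t))).trace = 0 := by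
  induction s with
  | zero => simp [comm]
  | add s s' hs hs' => rw [map_add, comm_add_left, map_add, Matrix.trace_add, hs, hs', add_zero]
  | tmul x y =>
    induction t with
    | zero => simp [comm]
    | add s s' hs hs' => rw [map_add, comm_add_right, map_add, Matrix.trace_add, hs, hs', add_zero]
    | tmul z b =>
      rw [legMap_tmul, legMap_tmul, comm, Algebra.TensorProduct.tmul_mul_tmul,
        Algebra.TensorProduct.tmul_mul_tmul, hj, map_sub, contractTail_tmul, contractTail_tmul,
        Matrix.trace_sub, Matrix.trace_smul, Matrix.trace_smul, Matrix.trace_mul_comm, sub_self]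

theorem trace_contractTail_comm_tail (β : Module.Dual ℂ B) {j : Sl N →ₗ[ℂ] B}
    (s : Sl N ⊗[ℂ] Sl N) (c : B) :
    (contractTail N β (comm (legMap j s) (1 ⊗ₜ[ℂ] c))).trace = 0 := by
  induction s with
  | zero => simp [comm]
  | add s s' hs hs' => rw [map_add, comm_add_left, map_add, Matrix.trace_add, hs, hs', add_zero]
  | tmul x y =>
    have hx : Matrix.trace x.1 = 0 := x.2
    rw [legMap_tmul, comm, Algebra.TensorProduct.tmul_mul_tmul,
      Algebra.TensorProduct.tmul_mul_tmul, mul_one, one_mul, map_sub, contractTail_tmul,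
      contractTail_tmul, Matrix.trace_sub, Matrix.trace_smul, Matrix.trace_smul, hx, smul_zero,
      smul_zero, sub_zero]

theorem legMap_regOp (h : IsCompl (adGraph g) (parabolicTriple N i)) (j : Sl N →ₗ[ℂ] B) (u v : ℂ)
    (t : Sl N ⊗[ℂ] Sl N) :
    legMap j (LinearMap.rTensor (Sl N) (regOp h u v) t) =
      legMap j (LinearMap.rTensor (Sl N) (constTerm h ∘ₗ seed N i v) t) +
        u • legMap j (LinearMap.rTensor (Sl N) (linTerm h ∘ₗ seed N i v) t) := by
  rw [regOp, LinearMap.rTensor_add, LinearMap.rTensor_smul, LinearMap.add_apply,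
    LinearMap.smul_apply, map_add, map_smul]

theorem legMap_sub_eq_peirce (h : IsCompl (adGraph g) (parabolicTriple N i)) (j : Sl N →ₗ[ℂ] B)
    (v : ℂ) (t : Sl N ⊗[ℂ] Sl N) :
    legMap j (LinearMap.rTensor (Sl N) (constTerm h ∘ₗ seed N i v) t) - legMap j t =
      peirce (firstLeg N B g.1) (firstLeg N B (g⁻¹).1) (legMap j (LinearMap.rTensor (Sl N)
        (leviPart N i ∘ₗ constTerm h ∘ₗ seed N i v + v • lowerPart N i +
          linTerm h ∘ₗ seed N i v) t)) := by
  rw [← peirce_legMap_eq (x := 1) (y := 1)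
    (S := constTerm h ∘ₗ seed N i v - LinearMap.id) (fun z => ?_) t]
  · rw [map_one, peirce, one_mul, mul_one, LinearMap.rTensor_sub, LinearMap.sub_apply,
      LinearMap.rTensor_id, LinearMap.id_apply, map_sub]
  · rw [one_mul, mul_one]
    exact congrArg Subtype.val (mem_adGraph_iff.1 (seed_mem_adGraph h v z))

theorem comm_peirce {A : Type*} [Ring A] {G G' : A} (hG : G' * G = 1) (x y : A) :
    comm (peirce G G' x) (peirce G G' y) = peirce G G' (comm x y) := by
  have key : ∀ x y, peirce G G' x * peirce G G' y = G * x * (G' * G) * y * G' := by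
    intro x y; simp only [peirce, mul_assoc]
  rw [comm, key, key, hG, comm, peirce_sub, peirce, peirce]
  simp only [mul_one, mul_assoc]

/-- Transversality in the first leg of a tensor product: if `(L, C)` satisfies the equations of the
graph and those of `(P_i, P_i, id)` in its first leg, then it vanishes. -/
theorem eq_zero_of_peirce (h : IsCompl (adGraph g) (parabolicTriple N i)) {C L : Mat N ⊗[ℂ] B}
    (hCL : C = peirce (firstLeg N B g.1) (firstLeg N B (g⁻¹).1) L)
    (htr : ∀ β, (contractTail N β C).trace = 0)
    (hC : peirce (firstLeg N B (projSnd N i)) (firstLeg N B (projFst N i)) C = 0)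
    (hL : peirce (firstLeg N B (projSnd N i)) (firstLeg N B (projFst N i)) L = 0)
    (hP : peirce (firstLeg N B (projFst N i)) (firstLeg N B (projFst N i)) L =
      peirce (firstLeg N B (projFst N i)) (firstLeg N B (projFst N i)) C)
    (hQ : peirce (firstLeg N B (projSnd N i)) (firstLeg N B (projSnd N i)) L =
      peirce (firstLeg N B (projSnd N i)) (firstLeg N B (projSnd N i)) C) :
    C = 0 ∧ L = 0 := by
  have key : ∀ β, contractTail N β C = 0 ∧ contractTail N β L = 0 := by
    intro β
    have hconj : contractTail N β C = g.1 * contractTail N β L * (g⁻¹).1 := by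
      rw [hCL, contractTail_peirce]
    have htrL : (contractTail N β L).trace = 0 := by
      rw [← htr β, hconj, Matrix.trace_mul_comm, ← mul_assoc, Units.inv_mul, one_mul]
    let y : Sl N := ⟨contractTail N β C, htr β⟩
    let x : Sl N := ⟨contractTail N β L, htrL⟩
    have hW : (x, y) ∈ adGraph g := mem_adGraph_iff.2 (Subtype.ext hconj)
    have hxy : (x, y) ∈ parabolicTriple N i := by
      rw [mem_parabolicTriple_iff]
      refine ⟨Subtype.ext ?_, Subtype.ext ?_, Subtype.ext ?_⟩
      · change projSnd N i * contractTail N β L * projFst N i = 0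
        rw [← contractTail_peirce, hL, map_zero]
      · change projSnd N i * contractTail N β C * projFst N i = 0
        rw [← contractTail_peirce, hC, map_zero]
      · rw [leviPart_coe, leviPart_coe]
        change projFst N i * contractTail N β L * projFst N i +
          projSnd N i * contractTail N β L * projSnd N i =
          projFst N i * contractTail N β C * projFst N i +
          projSnd N i * contractTail N β C * projSnd N i
        simp only [← contractTail_peirce, hP, hQ]
    have hz := Submodule.disjoint_def.1 h.disjoint _ hW hxy
    rw [Prod.mk_eq_zero] at hz
    exact ⟨congrArg Subtype.val hz.2, congrArg Subtype.val hz.1⟩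
  constructor
  · refine eq_of_forall_rid_lTensor fun β => ?_
    rw [map_zero, map_zero]
    exact (key β).1
  · refine eq_of_forall_rid_lTensor fun β => ?_
    rw [map_zero, map_zero]
    exact (key β).2

/-- If the residues of the Yang-Baxter expression in its first variable vanish, then the expression
vanishes. -/
theorem yangBaxter_of_residues (h : IsCompl (adGraph g) (parabolicTriple N i))
    {j₂ j₃ : Sl N →ₗ[ℂ] B} (hj : ∀ x y, j₂ x * j₃ y = j₃ y * j₂ x) (c : B) {u v w : ℂ}
    (huv : u ≠ v) (huw : u ≠ w) (hvw : v ≠ w)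
    (h₂ : comm (legMap j₂ (omega N)) ((w / (v - w)) • legMap j₃ (omega N) +
      legMap j₃ (LinearMap.rTensor (Sl N) (regOp h v w) (omega N)) + 1 ⊗ₜ[ℂ] c) = 0)
    (h₃ : comm (legMap j₃ (omega N)) ((v / (w - v)) • legMap j₂ (omega N) +
      legMap j₂ (LinearMap.rTensor (Sl N) (regOp h w v) (omega N)) - 1 ⊗ₜ[ℂ] c) = 0) :
    comm ((v / (u - v)) • legMap j₂ (omega N) +
          legMap j₂ (LinearMap.rTensor (Sl N) (regOp h u v) (omega N)))
        ((w / (u - w)) • legMap j₃ (omega N) +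
          legMap j₃ (LinearMap.rTensor (Sl N) (regOp h u w) (omega N))) +
      comm ((v / (u - v)) • legMap j₂ (omega N) +
          legMap j₂ (LinearMap.rTensor (Sl N) (regOp h u v) (omega N))) (1 ⊗ₜ[ℂ] c) +
      comm ((w / (u - w)) • legMap j₃ (omega N) +
          legMap j₃ (LinearMap.rTensor (Sl N) (regOp h u w) (omega N))) (1 ⊗ₜ[ℂ] c) = 0 := by
  rw [legMap_regOp] at h₂ h₃
  rw [legMap_regOp, legMap_regOp, yangBaxter_eq_polynomial huv huw hvw h₂ h₃]
  have hs : ∀ x y : Mat N, peirce (firstLeg N B x) (firstLeg N B y) ((1 : Mat N) ⊗ₜ[ℂ] c) =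
      (x * y) ⊗ₜ[ℂ] c := by
    intro x y
    rw [peirce_firstLeg_tmul, mul_one]
  obtain ⟨hC, hL, hP, hQ, hlin, hquad⟩ := peirce_yangBaxter (isPeircePair_firstLeg N i B) hvw h₂ h₃
    (by rw [hs, projFst_mul_projSnd, TensorProduct.zero_tmul])
    (by rw [hs, projSnd_mul_projFst, TensorProduct.zero_tmul])
    (isLegData_legMap h j₂ v (omega N)) (isLegData_legMap h j₃ w (omega N)) rfl rfl
  have hgg : firstLeg N B (g⁻¹).1 * firstLeg N B g.1 = 1 := by
    rw [← map_mul, Units.inv_mul, map_one]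
  have hcs : (1 : Mat N) ⊗ₜ[ℂ] c =
      peirce (firstLeg N B g.1) (firstLeg N B (g⁻¹).1) ((1 : Mat N) ⊗ₜ[ℂ] c) := by
    rw [hs, Units.mul_inv]
  have hzero := eq_zero_of_peirce h ?_ ?_ hC hL hP hQ
  · rw [hzero.1, hlin hzero.2, hquad, smul_zero, smul_zero, add_zero, add_zero]
  · rw [legMap_sub_eq_peirce, legMap_sub_eq_peirce]
    conv_lhs => rw [hcs]
    rw [comm_peirce hgg, comm_peirce hgg, comm_peirce hgg, ← peirce_add, ← peirce_add]
  · intro β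
    have hsub : ∀ (j : Sl N →ₗ[ℂ] B) (t t' : Sl N ⊗[ℂ] Sl N),
        legMap j t - legMap j t' = legMap j (t - t') := fun j t t' => (map_sub _ _ _).symm
    rw [hsub, hsub, map_add, map_add, Matrix.trace_add, Matrix.trace_add,
      trace_contractTail_comm_legMap β hj, trace_contractTail_comm_tail,
      trace_contractTail_comm_tail, add_zero, add_zero]

end Contraction

/-! ### The Yang-Baxter equation -/

section TripleTensor

variable {A₁ A₂ A₃ : Type*} [Ring A₁] [Algebra ℂ A₁] [Ring A₂] [Algebra ℂ A₂] [Ring A₃]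
  [Algebra ℂ A₃]

theorem map_includeLeft_mul_tmul (x : A₁) (y : A₂) (z : A₃) :
    Algebra.TensorProduct.map (AlgHom.id ℂ A₁)
        (Algebra.TensorProduct.includeLeft : A₂ →ₐ[ℂ] A₂ ⊗[ℂ] A₃) (x ⊗ₜ[ℂ] y) *
      (1 : A₁) ⊗ₜ[ℂ] ((1 : A₂) ⊗ₜ[ℂ] z) = x ⊗ₜ[ℂ] (y ⊗ₜ[ℂ] z) := by
  simp

theorem map_includeLeft_mul_comm (t : A₁ ⊗[ℂ] A₂) (z : A₃) :
    Algebra.TensorProduct.map (AlgHom.id ℂ A₁)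
        (Algebra.TensorProduct.includeLeft : A₂ →ₐ[ℂ] A₂ ⊗[ℂ] A₃) t *
      (1 : A₁) ⊗ₜ[ℂ] ((1 : A₂) ⊗ₜ[ℂ] z) = (1 : A₁) ⊗ₜ[ℂ] ((1 : A₂) ⊗ₜ[ℂ] z) *
      Algebra.TensorProduct.map (AlgHom.id ℂ A₁)
        (Algebra.TensorProduct.includeLeft : A₂ →ₐ[ℂ] A₂ ⊗[ℂ] A₃) t := by
  induction t with
  | zero => simp
  | tmul x y => simp
  | add s t hs ht => rw [map_add, add_mul, mul_add, hs, ht]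

theorem map_includeRight_mul_tmul (x : A₁) (y : A₂) (z : A₃) :
    Algebra.TensorProduct.map (AlgHom.id ℂ A₁)
        (Algebra.TensorProduct.includeRight : A₃ →ₐ[ℂ] A₂ ⊗[ℂ] A₃) (x ⊗ₜ[ℂ] z) *
      (1 : A₁) ⊗ₜ[ℂ] (y ⊗ₜ[ℂ] (1 : A₃)) = x ⊗ₜ[ℂ] (y ⊗ₜ[ℂ] z) := by
  simp

theorem map_includeRight_mul_comm (t : A₁ ⊗[ℂ] A₃) (y : A₂) :
    Algebra.TensorProduct.map (AlgHom.id ℂ A₁)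
        (Algebra.TensorProduct.includeRight : A₃ →ₐ[ℂ] A₂ ⊗[ℂ] A₃) t *
      (1 : A₁) ⊗ₜ[ℂ] (y ⊗ₜ[ℂ] (1 : A₃)) = (1 : A₁) ⊗ₜ[ℂ] (y ⊗ₜ[ℂ] (1 : A₃)) *
      Algebra.TensorProduct.map (AlgHom.id ℂ A₁)
        (Algebra.TensorProduct.includeRight : A₃ →ₐ[ℂ] A₂ ⊗[ℂ] A₃) t := by
  induction t with
  | zero => simp
  | tmul x y => simp
  | add s t hs ht => rw [map_add, add_mul, mul_add, hs, ht]

end TripleTensor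

/-- `b ↦ b ⊗ 1`. -/
def inclTwo (N : ℕ) : Sl N →ₗ[ℂ] Mat N ⊗[ℂ] Mat N :=
  (Algebra.TensorProduct.includeLeft : Mat N →ₐ[ℂ] Mat N ⊗[ℂ] Mat N).toLinearMap ∘ₗ
    (LieAlgebra.SpecialLinear.sl (Fin N) ℂ).toSubmodule.subtype

/-- `b ↦ 1 ⊗ b`. -/
def inclThree (N : ℕ) : Sl N →ₗ[ℂ] Mat N ⊗[ℂ] Mat N :=
  (Algebra.TensorProduct.includeRight : Mat N →ₐ[ℂ] Mat N ⊗[ℂ] Mat N).toLinearMap ∘ₗ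
    (LieAlgebra.SpecialLinear.sl (Fin N) ℂ).toSubmodule.subtype

/-- The algebra in which the Yang-Baxter equation is stated. -/
abbrev Cube (N : ℕ) : Type := Mat N ⊗[ℂ] (Mat N ⊗[ℂ] Mat N)

theorem leg12_eq (t : Sl N ⊗[ℂ] Sl N) : leg12 N t = legMap (inclTwo N) t := by
  induction t with
  | zero => simp [leg12]
  | tmul x y => rfl
  | add s t hs ht => rw [map_add, ← hs, ← ht]; simp only [leg12, map_add]

theorem leg13_eq (t : Sl N ⊗[ℂ] Sl N) : leg13 N t = legMap (inclThree N) t := by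
  induction t with
  | zero => simp [leg13]
  | tmul x y => rfl
  | add s t hs ht => rw [map_add, ← hs, ← ht]; simp only [leg13, map_add]

/-- `leg23` as a linear map. -/
def leg23Hom (N : ℕ) : Sl N ⊗[ℂ] Sl N →ₗ[ℂ] Cube N :=
  (Algebra.TensorProduct.includeRight : Mat N ⊗[ℂ] Mat N →ₐ[ℂ] Cube N).toLinearMap ∘ₗ slIncl N

theorem leg23Hom_apply (t : Sl N ⊗[ℂ] Sl N) : leg23Hom N t = leg23 N t := rfl

/-- The inclusion of the first two legs. -/
def leg12Hom (N : ℕ) : Mat N ⊗[ℂ] Mat N →ₐ[ℂ] Cube N :=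
  Algebra.TensorProduct.map (AlgHom.id ℂ (Mat N)) Algebra.TensorProduct.includeLeft

/-- The inclusion of the first and the third leg. -/
def leg13Hom (N : ℕ) : Mat N ⊗[ℂ] Mat N →ₐ[ℂ] Cube N :=
  Algebra.TensorProduct.map (AlgHom.id ℂ (Mat N)) Algebra.TensorProduct.includeRight

/-- The residue of the Yang-Baxter expression at `u₁ = u₂` vanishes. -/
theorem comm_leg12_omega (t : Sl N ⊗[ℂ] Sl N) :
    comm (leg12 N (omega N)) (leg13 N t + leg23 N t) = 0 := by
  have h₁ : ∀ x y : Sl N, legMap (inclThree N) (x ⊗ₜ[ℂ] y) = leg12Hom N (x.1 ⊗ₜ[ℂ] 1) *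
      (1 : Mat N) ⊗ₜ[ℂ] ((1 : Mat N) ⊗ₜ[ℂ] y.1) :=
    fun x y => (leg13_eq _).symm.trans (map_includeLeft_mul_tmul x.1 1 y.1).symm
  have h₂ : ∀ x y : Sl N, leg23Hom N (x ⊗ₜ[ℂ] y) = leg12Hom N (1 ⊗ₜ[ℂ] x.1) *
      (1 : Mat N) ⊗ₜ[ℂ] ((1 : Mat N) ⊗ₜ[ℂ] y.1) :=
    fun x y => (map_includeLeft_mul_tmul 1 x.1 y.1).symm
  have hε : ∀ (t : Mat N ⊗[ℂ] Mat N) (y : Mat N),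
      leg12Hom N t * (1 : Mat N) ⊗ₜ[ℂ] ((1 : Mat N) ⊗ₜ[ℂ] y) =
      (1 : Mat N) ⊗ₜ[ℂ] ((1 : Mat N) ⊗ₜ[ℂ] y) * leg12Hom N t :=
    map_includeLeft_mul_comm
  have hl := comm_omega_map (A := Cube N) (leg12Hom N)
    (fun y => (1 : Mat N) ⊗ₜ[ℂ] ((1 : Mat N) ⊗ₜ[ℂ] y)) hε (legMap (inclThree N)) (leg23Hom N)
    h₁ h₂ t
  rw [← leg13_eq] at hl
  exact hl

/-- The residue of the Yang-Baxter expression at `u₁ = u₃` vanishes, by unitarity. -/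
theorem comm_leg13_omega (t : Sl N ⊗[ℂ] Sl N) :
    comm (leg13 N (omega N))
      (leg12 N t + leg23 N (TensorProduct.comm ℂ (Sl N) (Sl N) t)) = 0 := by
  have h₁ : ∀ x y : Sl N, legMap (inclTwo N) (x ⊗ₜ[ℂ] y) = leg13Hom N (x.1 ⊗ₜ[ℂ] 1) *
      (1 : Mat N) ⊗ₜ[ℂ] (y.1 ⊗ₜ[ℂ] (1 : Mat N)) :=
    fun x y => (leg12_eq _).symm.trans (map_includeRight_mul_tmul x.1 y.1 1).symm
  have h₂ : ∀ x y : Sl N, leg23Hom N (y ⊗ₜ[ℂ] x) = leg13Hom N (1 ⊗ₜ[ℂ] x.1) *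
      (1 : Mat N) ⊗ₜ[ℂ] (y.1 ⊗ₜ[ℂ] (1 : Mat N)) :=
    fun x y => (map_includeRight_mul_tmul 1 y.1 x.1).symm
  have hε : ∀ (t : Mat N ⊗[ℂ] Mat N) (y : Mat N),
      leg13Hom N t * (1 : Mat N) ⊗ₜ[ℂ] (y ⊗ₜ[ℂ] (1 : Mat N)) =
      (1 : Mat N) ⊗ₜ[ℂ] (y ⊗ₜ[ℂ] (1 : Mat N)) * leg13Hom N t :=
    map_includeRight_mul_comm
  have hl := comm_omega_map (A := Cube N) (leg13Hom N)
    (fun y => (1 : Mat N) ⊗ₜ[ℂ] (y ⊗ₜ[ℂ] (1 : Mat N))) hε (legMap (inclTwo N))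
    (leg23Hom N ∘ₗ (TensorProduct.comm ℂ (Sl N) (Sl N)).toLinearMap) h₁ h₂ t
  rw [← leg12_eq] at hl
  exact hl

theorem isCYBESolution_rMat_rPoly (h : IsCompl (adGraph g) (parabolicTriple N i)) :
    IsCYBESolution (rMat (rPoly h)) := by
  intro u v w huv huw hvw
  have hj : ∀ x y, inclTwo N x * inclThree N y = inclThree N y * inclTwo N x := by
    intro x y
    change (x.1 ⊗ₜ[ℂ] (1 : Mat N)) * ((1 : Mat N) ⊗ₜ[ℂ] y.1) =
      ((1 : Mat N) ⊗ₜ[ℂ] y.1) * (x.1 ⊗ₜ[ℂ] (1 : Mat N))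
    simp
  have h₂ := comm_leg12_omega (rMat (rPoly h) v w)
  have h₃ := comm_leg13_omega (rMat (rPoly h) w v)
  have hunit : leg23 N (TensorProduct.comm ℂ (Sl N) (Sl N) (rMat (rPoly h) w v)) =
      -leg23 N (rMat (rPoly h) v w) := by
    rw [← leg23Hom_apply, ← leg23Hom_apply, ← map_neg, isUnitary_rMat_rPoly h v w hvw, neg_neg]
  rw [hunit, ← sub_eq_add_neg] at h₃
  have hleg : ∀ (j : Sl N →ₗ[ℂ] Mat N ⊗[ℂ] Mat N) {a b : ℂ}, a ≠ b →
      legMap j (rMat (rPoly h) a b) = (b / (a - b)) • legMap j (omega N) +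
        legMap j (LinearMap.rTensor (Sl N) (regOp h a b) (omega N)) := by
    intro j a b hab
    rw [rMat_rPoly h hab, map_add, map_smul]
  rw [leg12_eq, leg13_eq, hleg _ hvw] at h₂
  rw [leg12_eq, leg13_eq, hleg _ hvw.symm] at h₃
  rw [leg12_eq, leg13_eq, hleg _ huv, hleg _ huw]
  exact yangBaxter_of_residues h hj (slIncl N (rMat (rPoly h) v w)) huv huw hvw h₂ h₃

end

end QuasiTrig

theorem proposition2 (N : ℕ) (hN : 2 ≤ N) :
    -- `W` is a Lie subalgebra of `𝔰𝔩_N ⊕ 𝔰𝔩_N`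
    (∀ x ∈ QuasiTrig.cremmerGervaisI N, ∀ y ∈ QuasiTrig.cremmerGervaisI N,
      ⁅x, y⁆ ∈ QuasiTrig.cremmerGervaisI N) ∧
    -- `W` is Lagrangian for `Q`
    (QuasiTrig.formQ N).orthogonal (QuasiTrig.cremmerGervaisI N) = QuasiTrig.cremmerGervaisI N ∧
    -- `W` is transversal to `(P_{N-1}, P_{N-1}, id)`
    IsCompl (QuasiTrig.cremmerGervaisI N) (QuasiTrig.parabolicTriple N (N - 1)) ∧
    -- `W` defines exactly one `r`-matrix, and this is quasi-trigonometric
    ∃ p : QuasiTrig.TensorPoly N,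
      QuasiTrig.IsDefinedBy (N - 1) p (QuasiTrig.cremmerGervaisI N) ∧
      (∀ p' : QuasiTrig.TensorPoly N,
        QuasiTrig.IsDefinedBy (N - 1) p' (QuasiTrig.cremmerGervaisI N) → p' = p) ∧
      QuasiTrig.IsQuasiTrigonometric p ∧
      QuasiTrig.IsUnitary (QuasiTrig.rMat p) := by
  rw [QuasiTrig.cremmerGervaisI_eq_adGraph]
  have h := QuasiTrig.isCompl_adGraph_parabolicTriple hN
  have hp := QuasiTrig.isDefinedBy_rPoly h
  exact ⟨fun x hx y hy => QuasiTrig.lie_mem_adGraph hx hy,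
    QuasiTrig.orthogonal_adGraph (by omega) _, h, QuasiTrig.rPoly h, hp,
    fun p' hp' => QuasiTrig.isDefinedBy_unique h hp hp',
    ⟨QuasiTrig.ne_zero_of_isDefinedBy (by omega) (by omega) hp,
      QuasiTrig.isCYBESolution_rMat_rPoly h⟩,
    QuasiTrig.isUnitary_rMat_rPoly h⟩
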